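/- For $a>0$ let $\Pi_0(a)$ be the comb domain obtained from the half strip $\{\psi+i\phi:-1<\psi<0,\ \phi>0\}$ by removing the closed vertical slits $[-k2^{-m},\,-k2^{-m}+ia2^{-m}]$ for $m\ge 1$ and odd $k\in\mathbb N$ with $k\le 2^m$. Let $2\Pi_0(a)$ be the union of $\Pi_0(a)$, its reflection across the line $\operatorname{Re}=-1$, and the half-line $\{-1+it:t>a\}$. Write $\mathbb C_+$ for the open upper half-plane. For every $a>0$ the following objects are well defined: the unique conformal map $\vartheta_0:\mathbb C_+\to\Pi_0(a)$ (onto) that extends continuously to $\overline{\mathbb C_+}\cup\{\infty\}$ with $\vartheta_0(-1)=-1$, $\vartheta_0(1)=0$, $\vartheta_0(\infty)=\infty$ (the extension is also denoted $\vartheta_0$); the unique real number $\nu=\nu(a)$ with $\vartheta_0(-\nu)=-1+ia$; and the conformal map $\vartheta:\mathbb C\setminus[-\nu,\infty)\to 2\Pi_0(a)$ (onto) given by $\vartheta=\vartheta_0$ on $\mathbb C_+\cup(-\infty,-\nu)$ and $\vartheta(z)=-2-\overline{\vartheta_0(\bar z)}$ for $\operatorname{Im} z<0$. **Theorem.** Let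 $\lambda>2$ and $P(z)=z^2-\lambda$. There is a unique $a>0$ such that, with $\xi=\nu(a)+1$, $\theta_0(z)=\vartheta_0(z/\xi)$ and $\theta(z)=\vartheta(z/\xi)$ (so that $\theta_0:\mathbb C_+\to\Pi_0(a)$ and $\theta:\mathbb C\setminus[-\xi\nu(a),\infty)\to2\Pi_0(a)$ are conformal maps onto), $$P(z)=\theta^{-1}(2\theta_0(z)),\qquad z\in\mathbb C_+ .$$ For this $a$: 1. $\xi$ is the positive fixed point of $P$. 2. Let $G(z)=e^{i\pi\theta(z)}$, where on the real axis $\theta$ is given its boundary values from the upper half-plane. Then $G$ is analytic in $\mathbb C\setminus[-\xi,\xi]$, $P$ maps $\mathbb C\setminus[-\xi,\xi]$ into itself, and $G(P(z))=G(z)^2$ for all $z\in\mathbb C\setminus[-\xi,\xi]$. At $x\in[-\xi,\xi]$ the function $G$ has the boundary value $G(x)$ from above and $\overline{G(x)}$ from below, and the identity persists for boundary values: $G(P(x))=G(x)^2$ if $0\le x\le\xi$, and $\overline{G(P(x))}=G(x)^2$ if $-\xi\le x\le 0$. 3. The set $E_0=\{z\in\overline{\mathbb C_+}:\theta_0(z)\in[-1,0]\}$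 is the Julia set of $P$, that is, the complement in $\mathbb C$ of the basin of attraction of infinity $\{z: P^{\circ n}(z)\to\infty\}$. -/

import Mathlib

open Set Filter Topology Complex

/-- The open upper half-plane. -/
def openUpper : Set ℂ := {z | 0 < z.im}

/-- The closed upper half-plane (without the point at infinity). -/
def closedUpper : Set ℂ := {z | 0 ≤ z.im}

/-- The plane cut along the real half-line `[c, ∞)`. -/
def cutPlane (c : ℝ) : Set ℂ := {z | ¬ (z.im = 0 ∧ c ≤ z.re)}

/-- The real interval `[-c, c]` as a subset of the plane. -/
def realInterval (c : ℝ) : Set ℂ := {z | z.im = 0 ∧ z.re ∈ Icc (-c) c}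

/-- The comb domain over the base interval `(-1, 0)`: the vertical half strip, from which the closed
vertical slits with foot `-k / 2 ^ m` and height `a / 2 ^ m` (`m ≥ 1`, `k ≤ 2 ^ m` odd) are
removed. -/
def combDomain (a : ℝ) : Set ℂ :=
  {z | z.re ∈ Ioo (-1 : ℝ) 0 ∧ 0 < z.im} \
    ⋃ (m : ℕ) (k : ℕ) (_ : 1 ≤ m ∧ Odd k ∧ k ≤ 2 ^ m),
      segment ℝ (-(k : ℂ) / 2 ^ m) (-(k : ℂ) / 2 ^ m + (a : ℂ) / 2 ^ m * I)

/-- The reflection across the vertical line `Re z = -1`. -/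
noncomputable def reflectLine (z : ℂ) : ℂ := -2 - (starRingEnd ℂ) z

/-- The doubled comb domain over the base interval `(-2, 0)`. -/
def doubledComb (a : ℝ) : Set ℂ :=
  reflectLine '' combDomain a ∪ {z | z.re = -1 ∧ a < z.im} ∪ combDomain a

/-- `f` maps `U` conformally (holomorphically and bijectively) onto `V`. -/
def ConformalOnto (f : ℂ → ℂ) (U V : Set ℂ) : Prop :=
  DifferentiableOn ℂ f U ∧ BijOn f U V

/-- `f`, restricted to the closed upper half-plane, is the continuous extension to the boundary of
a conformal map of the upper half-plane onto the comb domain, normalised by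
`f (-1) = -1`, `f 1 = 0`, `f ∞ = ∞`. The values of `f` below the real axis play no role. -/
structure IsCombMap (a : ℝ) (f : ℂ → ℂ) : Prop where
  conformal : ConformalOnto f openUpper (combDomain a)
  continuousOn : ContinuousOn f closedUpper
  map_neg_one : f (-1) = -1
  map_one : f 1 = 0
  map_infty : Tendsto f (cocompact ℂ ⊓ 𝓟 closedUpper) (cocompact ℂ)

open Classical in
/-- The extension of `f` by reflection (in the real axis and in the line `Re = -1`) to the lower
half-plane. On the real axis it takes the boundary values of `f` from above. -/
noncomputable def reflectedExtension (f : ℂ → ℂ) (z : ℂ) : ℂ :=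
  if 0 ≤ z.im then f z else reflectLine (f ((starRingEnd ℂ) z))

/-- Precomposition with `z ↦ z / ξ`. -/
noncomputable def rescale (ξ : ℝ) (f : ℂ → ℂ) (z : ℂ) : ℂ := f (z / ξ)

/-- The quadratic polynomial `z ^ 2 - lam`. -/
noncomputable def quadMap (lam : ℝ) (z : ℂ) : ℂ := z ^ 2 - lam

/-- The basin of attraction of infinity of `z ^ 2 - lam`. -/
def basinOfInfinity (lam : ℝ) : Set ℂ :=
  {z | Tendsto (fun n : ℕ => (quadMap lam)^[n] z) atTop (cocompact ℂ)}

/-- The Julia set of `z ^ 2 - lam` for real `lam > 2`: the complement of the basin of infinity. -/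
def juliaSet (lam : ℝ) : Set ℂ := (basinOfInfinity lam)ᶜ

/-- The function `exp (i π θ)`. -/
noncomputable def expPi (θ : ℂ → ℂ) (z : ℂ) : ℂ := Complex.exp (I * Real.pi * θ z)

/-- The identity `P = θ⁻¹ ∘ 2 θ₀` on the upper half-plane, where `P z = z ^ 2 - lam`, `ξ = ν + 1`,
`θ₀ z = f (z / ξ)` and `θ` is the map `z ↦ f (z / ξ)` extended by reflection to the plane cut along
`[-ξ ν, ∞)`: the value `P z` lies in the domain of `θ`, and `θ` takes the value `2 θ₀ z` there. -/
def CombRepresents (lam : ℝ) (f : ℂ → ℂ) (ν : ℝ) : Prop :=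
  ∀ z ∈ openUpper, quadMap lam z ∈ cutPlane (-((ν + 1) * ν)) ∧
    rescale (ν + 1) (reflectedExtension f) (quadMap lam z) = 2 * rescale (ν + 1) f z

/-!
The idea is to construct the comb map from the dynamics of the polynomial instead of starting from
the comb, so that neither the Riemann mapping theorem nor boundary extension theorems are needed.

Write `lam = ξ ^ 2 - ξ` with the fixed point `ξ > 2` and `P z = z ^ 2 - lam`. The equation
`2 θ₀ = ext θ₀ ∘ P`, where `ext` is the extension by reflection, says that `θ₀` is a fixed point of the
pull-back operator `combLift ξ`. This operator preserves the maps into the half-strip with the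
right boundary behaviour outside of `[-ξ, ξ]` (`IsStripMap`) and halves distances, so its iterates,
started at a continuous modification of `(i / π) log z`, converge uniformly on the closed half-plane
to a continuous solution `combLimit ξ`. Where an orbit has escaped, the approximations are
`(i / π) 2⁻ⁿ log P^[n]`; since non-real orbits escape, `combLimit ξ` is holomorphic. All preimages of
`[-ξ, ξ]` under `P^[n]` are real, hence `(P^[n])' / P^[n]` is a sum of terms `1 / (z - t)` with `t` real,
the derivative of `combLimit ξ` has positive real part, and `combLimit ξ` is injective
(`injOn_combLimit`).

The functional equation identifies the image. Doubling and folding takes a slit of level `m` to one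
of level `m - 1`, and the middle slit has the height `combHeight ξ / 2`, where `combHeight ξ` is the
imaginary part at the critical value. So the half-plane goes into the comb domain and the real axis
into its complement; the image is open and relatively closed in the connected comb domain, and
therefore all of it (`image_combLimit`). The Green function `π Im (combLimit ξ)` vanishes exactly on
the bounded orbits, which is the description of the Julia set.

By the intermediate value theorem every `a > 0` is some `combHeight ξ` (`exists_combHeight_eq`), and
a comb map is unique, because the automorphisms of the half-plane fixing `∞` are affine by the
Schwarz lemma (`IsCombMap.eqOn_combLimit`). So all comb maps are of the form `z ↦ combLimit ξ (ξ z)`.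
Such a map represents only the polynomial it comes from, since `ext (combLimit ξ)` is injective
(`combRepresents_iff`); this gives the uniqueness of `a`. Finally `G = exp (i π θ)` is holomorphic off
`[-ξ, ξ]`: it is continuous there and satisfies `G ∘ P = G ^ 2`, and this equation transports
holomorphy back along the escaping orbits (`differentiableAt_combExp`).
-/

open scoped ComplexConjugate

variable {ξ : ℝ}

/-! ### Dynamics of the quadratic polynomial -/

/-- The quadratic polynomial `z ^ 2 - lam`, parametrised by its fixed point `ξ`:
`lam = ξ ^ 2 - ξ`. For `ξ > 2` this covers exactly the parameters `lam > 2`. -/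
noncomputable abbrev quadFix (ξ : ℝ) : ℂ → ℂ := quadMap (ξ ^ 2 - ξ)

lemma quadFix_apply (z : ℂ) : quadFix ξ z = z ^ 2 - ((ξ : ℂ) ^ 2 - ξ) := by
  simp [quadMap]

lemma quadFix_conj (z : ℂ) : quadFix ξ (conj z) = conj (quadFix ξ z) := by
  simp [quadFix_apply]

lemma quadFix_neg (z : ℂ) : quadFix ξ (-z) = quadFix ξ z := by
  simp [quadFix_apply]

lemma quadFix_ofReal (x : ℝ) : quadFix ξ (x : ℂ) = ((x ^ 2 - (ξ ^ 2 - ξ) : ℝ) : ℂ) := by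
  simp [quadFix_apply]

lemma quadFix_im (z : ℂ) : (quadFix ξ z).im = 2 * z.re * z.im := by
  rw [quadFix_apply, ← ofReal_pow, ← ofReal_sub, sub_im, ofReal_im, pow_two, mul_im]; ring

lemma quadFix_re (z : ℂ) : (quadFix ξ z).re = z.re ^ 2 - z.im ^ 2 - (ξ ^ 2 - ξ) := by
  rw [quadFix_apply, ← ofReal_pow, ← ofReal_sub, sub_re, ofReal_re, pow_two, mul_re]; ring

lemma continuous_quadFix : Continuous (quadFix ξ) := by
  have : quadFix ξ = fun z : ℂ => z ^ 2 - ((ξ : ℂ) ^ 2 - ξ) := funext quadFix_apply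
  rw [this]; fun_prop

lemma differentiable_quadFix : Differentiable ℂ (quadFix ξ) := by
  have : quadFix ξ = fun z : ℂ => z ^ 2 - ((ξ : ℂ) ^ 2 - ξ) := funext quadFix_apply
  rw [this]; fun_prop

lemma hasDerivAt_quadFix (z : ℂ) : HasDerivAt (quadFix ξ) (2 * z) z := by
  have : quadFix ξ = fun z : ℂ => z ^ 2 - ((ξ : ℂ) ^ 2 - ξ) := funext quadFix_apply
  rw [this]
  simpa using (hasDerivAt_pow 2 z).sub_const ((ξ : ℂ) ^ 2 - ξ)

lemma iterate_quadFix_conj (n : ℕ) (z : ℂ) :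
    (quadFix ξ)^[n] (conj z) = conj ((quadFix ξ)^[n] z) := by
  induction n generalizing z with
  | zero => rfl
  | succ n ih => rw [Function.iterate_succ_apply, quadFix_conj, ih, Function.iterate_succ_apply]

/-- Translates of the polynomial by points of `[-ξ, ξ]` have two real roots in `[-ξ, ξ]`. By
induction, all preimages of such points under the iterates are real. -/
lemma exists_quadFix_sub_eq_mul (hξ : 2 < ξ) {s : ℝ} (hs : s ∈ Icc (-ξ) ξ) :
    ∃ r : ℝ, r ∈ Icc (-ξ) ξ ∧ -r ∈ Icc (-ξ) ξ ∧
      ∀ z : ℂ, quadFix ξ z - s = (z - r) * (z - ((-r : ℝ) : ℂ)) := by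
  have h0 : 0 ≤ ξ ^ 2 - ξ + s := by nlinarith [hs.1]
  have h1 : √(ξ ^ 2 - ξ + s) ≤ ξ := by
    apply Real.sqrt_le_iff.2 ⟨by linarith, by linarith [hs.2]⟩
  have h2 := Real.sqrt_nonneg (ξ ^ 2 - ξ + s)
  refine ⟨√(ξ ^ 2 - ξ + s), ⟨by linarith, h1⟩, ⟨by linarith, by linarith⟩, fun z => ?_⟩
  have h3 : ((√(ξ ^ 2 - ξ + s) : ℝ) : ℂ) ^ 2 = ξ ^ 2 - ξ + s := by
    rw [← ofReal_pow, Real.sq_sqrt h0]; push_cast; ring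
  rw [quadFix_apply]
  push_cast
  linear_combination h3

lemma le_norm_quadFix (hξ : 2 < ξ) (z : ℂ) : 2 * ξ * (‖z‖ - ξ) + ξ ≤ ‖quadFix ξ z‖ := by
  have h : ‖z ^ 2‖ - ‖((ξ ^ 2 - ξ : ℝ) : ℂ)‖ ≤ ‖quadFix ξ z‖ := norm_sub_norm_le _ _
  rw [norm_pow, norm_real, Real.norm_of_nonneg (by nlinarith)] at h
  nlinarith [sq_nonneg (‖z‖ - ξ)]

lemma le_norm_iterate_quadFix (hξ : 2 < ξ) {z : ℂ} (hz : ξ ≤ ‖z‖) (n : ℕ) :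
    ξ + 2 ^ n * (‖z‖ - ξ) ≤ ‖(quadFix ξ)^[n] z‖ := by
  induction n with
  | zero => simp
  | succ n ih =>
    rw [Function.iterate_succ_apply']
    refine le_trans ?_ (le_norm_quadFix hξ _)
    have : 0 ≤ 2 ^ n * (‖z‖ - ξ) := mul_nonneg (by positivity) (by linarith)
    rw [pow_succ]
    nlinarith

lemma lt_norm_iterate_quadFix (hξ : 2 < ξ) {z : ℂ} (hz : ξ < ‖z‖) (n : ℕ) :
    ξ < ‖(quadFix ξ)^[n] z‖ := by
  have h := le_norm_iterate_quadFix hξ hz.le n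
  have : 0 < 2 ^ n * (‖z‖ - ξ) := mul_pos (by positivity) (by linarith)
  linarith

lemma lt_norm_iterate_quadFix_of_le (hξ : 2 < ξ) {z : ℂ} {m n : ℕ} (hmn : m ≤ n)
    (hz : ξ < ‖(quadFix ξ)^[m] z‖) : ξ < ‖(quadFix ξ)^[n] z‖ := by
  obtain ⟨k, rfl⟩ := Nat.exists_eq_add_of_le hmn
  rw [add_comm, Function.iterate_add_apply]
  exact lt_norm_iterate_quadFix hξ hz k

lemma tendsto_norm_iterate_quadFix (hξ : 2 < ξ) {z : ℂ} (hz : ξ < ‖z‖) :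
    Tendsto (fun n => ‖(quadFix ξ)^[n] z‖) atTop atTop := by
  refine tendsto_atTop_mono (le_norm_iterate_quadFix hξ hz.le) ?_
  refine tendsto_atTop_add_const_left _ _ ?_
  exact (tendsto_pow_atTop_atTop_of_one_lt one_lt_two).atTop_mul_const (by linarith)

/-- Escape criterion: an orbit tends to infinity as soon as it leaves the disk of radius `ξ`. -/
lemma mem_basinOfInfinity_iff (hξ : 2 < ξ) (z : ℂ) :
    z ∈ basinOfInfinity (ξ ^ 2 - ξ) ↔ ∃ n, ξ < ‖(quadFix ξ)^[n] z‖ := by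
  constructor
  · intro h
    have := tendsto_norm_cocompact_atTop.comp (show Tendsto _ _ _ from h)
    exact (this.eventually (eventually_gt_atTop ξ)).exists
  · rintro ⟨n, hn⟩
    have h := tendsto_norm_iterate_quadFix hξ hn
    have h2 : Tendsto (fun k => ‖(quadFix ξ)^[k + n] z‖) atTop atTop := by
      simpa only [Function.iterate_add_apply] using h
    have h3 := (tendsto_add_atTop_iff_nat (f := fun k => ‖(quadFix ξ)^[k] z‖) n).1 h2
    exact tendsto_cocompact_of_tendsto_dist_comp_atTop (0 : ℂ) (by simpa using h3)

/-- A comparison of the distances of `z` and `w` to all points of `[-ξ, ξ]` is amplified by the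
iterates, because all roots of `P^[n] - s` lie in `[-ξ, ξ]`. -/
lemma pow_mul_norm_iterate_sub_le (hξ : 2 < ξ) {z w : ℂ} {q : ℝ} (hq : 0 ≤ q)
    (h : ∀ s ∈ Icc (-ξ) ξ, q * ‖w - s‖ ≤ ‖z - s‖) (n : ℕ) {s : ℝ} (hs : s ∈ Icc (-ξ) ξ) :
    q ^ (2 ^ n) * ‖(quadFix ξ)^[n] w - s‖ ≤ ‖(quadFix ξ)^[n] z - s‖ := by
  induction n generalizing s with
  | zero => simpa using h s hs
  | succ n ih =>
    obtain ⟨r, hr, hr', hf⟩ := exists_quadFix_sub_eq_mul hξ hs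
    rw [Function.iterate_succ_apply', Function.iterate_succ_apply', hf, hf, norm_mul, norm_mul]
    calc q ^ 2 ^ (n + 1) * (‖(quadFix ξ)^[n] w - r‖ * ‖(quadFix ξ)^[n] w - ((-r : ℝ) : ℂ)‖)
        = (q ^ 2 ^ n * ‖(quadFix ξ)^[n] w - r‖) *
          (q ^ 2 ^ n * ‖(quadFix ξ)^[n] w - ((-r : ℝ) : ℂ)‖) := by ring
      _ ≤ _ := mul_le_mul (ih hr) (ih hr') (by positivity) (by positivity)

/-- Non-real orbits escape. If the orbit of `z` were bounded by `ξ`, then comparison with the orbit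
of `Re z` shows that the distance from the orbit to one of the points `± ξ` grows without bound. -/
lemma exists_lt_norm_iterate_of_im_ne_zero (hξ : 2 < ξ) {z : ℂ} (hz : z.im ≠ 0) :
    ∃ n, ξ < ‖(quadFix ξ)^[n] z‖ := by
  by_contra! hcon
  have hre : |z.re| ≤ ξ := (abs_re_le_norm z).trans (hcon 0)
  set q : ℝ := √(1 + z.im ^ 2 / (4 * ξ ^ 2)) with hq
  have hpos : 0 < z.im ^ 2 / (4 * ξ ^ 2) := by positivity
  have hq1 : 1 < q := by rw [hq, Real.lt_sqrt (by norm_num)]; linarith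
  have hq2 : q ^ 2 = 1 + z.im ^ 2 / (4 * ξ ^ 2) := Real.sq_sqrt (by positivity)
  have key : ∀ s ∈ Icc (-ξ) ξ, q * ‖((z.re : ℝ) : ℂ) - s‖ ≤ ‖z - s‖ := by
    intro s hs
    apply le_of_sq_le_sq _ (norm_nonneg _)
    rw [mul_pow, hq2, ← ofReal_sub, norm_real, Real.norm_eq_abs, sq_abs, Complex.sq_norm,
      normSq_apply]
    simp only [sub_re, ofReal_re, sub_im, ofReal_im, sub_zero]
    have h1 : (z.re - s) ^ 2 ≤ 4 * ξ ^ 2 := by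
      have := abs_le.1 hre
      nlinarith [hs.1, hs.2]
    have h2 : z.im ^ 2 / (4 * ξ ^ 2) * (z.re - s) ^ 2 ≤ z.im ^ 2 := by
      rw [div_mul_eq_mul_div, div_le_iff₀ (by positivity)]
      exact mul_le_mul_of_nonneg_left h1 (sq_nonneg _)
    nlinarith
  have hreal : ∀ n, ∃ x : ℝ, (quadFix ξ)^[n] ((z.re : ℝ) : ℂ) = x := by
    intro n
    induction n with
    | zero => exact ⟨_, rfl⟩
    | succ n ih =>
      obtain ⟨x, hx⟩ := ih
      exact ⟨_, by rw [Function.iterate_succ_apply', hx, quadFix_ofReal]⟩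
  have hb : ∀ n : ℕ, q ^ (2 ^ n) * ξ ≤ 2 * ξ := by
    intro n
    obtain ⟨x, hx⟩ := hreal n
    have hfar : ∃ s ∈ Icc (-ξ) ξ, ξ ≤ |x - s| ∧ |s| ≤ ξ := by
      rcases le_total x 0 with h | h
      · exact ⟨ξ, ⟨by linarith, le_rfl⟩, by rw [abs_of_nonpos] <;> linarith,
          by rw [abs_of_pos] ; linarith⟩
      · exact ⟨-ξ, ⟨le_rfl, by linarith⟩, by rw [abs_of_nonneg] <;> linarith,
          by rw [abs_neg, abs_of_pos] ; linarith⟩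
    obtain ⟨s, hs, hxs, hs'⟩ := hfar
    have h1 := pow_mul_norm_iterate_sub_le hξ (by linarith) key n hs
    rw [hx, ← ofReal_sub, norm_real, Real.norm_eq_abs] at h1
    have h2 : ‖(quadFix ξ)^[n] z - s‖ ≤ ξ + ξ := by
      refine (norm_sub_le _ _).trans (add_le_add (hcon n) ?_)
      rwa [norm_real, Real.norm_eq_abs]
    have h3 : q ^ (2 ^ n) * ξ ≤ q ^ (2 ^ n) * |x - s| :=
      mul_le_mul_of_nonneg_left hxs (by positivity)
    linarith
  have ht : Tendsto (fun n : ℕ => q ^ (2 ^ n)) atTop atTop :=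
    (tendsto_pow_atTop_atTop_of_one_lt hq1).comp
      (tendsto_pow_atTop_atTop_of_one_lt (by norm_num : (1 : ℕ) < 2))
  obtain ⟨n, hn⟩ := (ht.eventually (eventually_gt_atTop 2)).exists
  nlinarith [hb n]

/-- The partial fraction expansion `(P^[n])' / (P^[n] - s) = ∑ 1 / (z - t)` over real points
`t ∈ [-ξ, ξ]`, in the form of a bound for the imaginary part in the upper half-plane. -/
lemma logDeriv_iterate_quadFix (hξ : 2 < ξ) {z : ℂ} (hz : 0 < z.im) (n : ℕ) {s : ℝ}
    (hs : s ∈ Icc (-ξ) ξ) :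
    (quadFix ξ)^[n] z - s ≠ 0 ∧ (deriv (quadFix ξ)^[n] z / ((quadFix ξ)^[n] z - s)).im ≤
      -(2 ^ n * (z.im / (‖z‖ + ξ) ^ 2)) := by
  induction n generalizing s with
  | zero =>
    have h0 : z - s ≠ 0 := by
      intro h
      have := congrArg im h
      simp at this; linarith
    refine ⟨by simpa using h0, ?_⟩
    have h1 : 0 < normSq (z - s) := normSq_pos.2 h0
    have h2 : normSq (z - s) ≤ (‖z‖ + ξ) ^ 2 := by
      rw [← Complex.sq_norm]
      gcongr
      refine (norm_sub_le _ _).trans (add_le_add le_rfl ?_)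
      rw [norm_real, Real.norm_eq_abs, abs_le]; exact hs
    simp only [Function.iterate_zero, deriv_id, id, pow_zero, one_mul, one_div, inv_im, sub_im,
      ofReal_im, sub_zero, neg_div]
    gcongr
  | succ n ih =>
    obtain ⟨r, hr, hr', hf⟩ := exists_quadFix_sub_eq_mul hξ hs
    obtain ⟨h1, h1'⟩ := ih hr
    obtain ⟨h2, h2'⟩ := ih hr'
    have hd : deriv (quadFix ξ)^[n + 1] z
        = 2 * (quadFix ξ)^[n] z * deriv (quadFix ξ)^[n] z := by
      rw [Function.iterate_succ']
      exact ((hasDerivAt_quadFix _).comp z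
        ((differentiable_quadFix.iterate n) z).hasDerivAt).deriv
    rw [hd, Function.iterate_succ_apply', hf]
    refine ⟨mul_ne_zero h1 h2, ?_⟩
    have : 2 * (quadFix ξ)^[n] z * deriv (quadFix ξ)^[n] z /
          (((quadFix ξ)^[n] z - r) * ((quadFix ξ)^[n] z - ((-r : ℝ) : ℂ)))
        = deriv (quadFix ξ)^[n] z / ((quadFix ξ)^[n] z - r)
          + deriv (quadFix ξ)^[n] z / ((quadFix ξ)^[n] z - ((-r : ℝ) : ℂ)) := by
      field_simp
      push_cast
      ring
    rw [this, add_im, pow_succ]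
    linarith

/-! ### The pull-back operator and its fixed point -/

lemma isClosed_closedUpper : IsClosed closedUpper := isClosed_le continuous_const continuous_im

lemma isOpen_openUpper : IsOpen openUpper := isOpen_lt continuous_const continuous_im

lemma openUpper_subset_closedUpper : openUpper ⊆ closedUpper :=
  fun z (hz : 0 < z.im) => show 0 ≤ z.im from hz.le

lemma ofReal_mem_closedUpper (x : ℝ) : (x : ℂ) ∈ closedUpper := by simp [closedUpper]

@[simp] lemma reflectLine_re (z : ℂ) : (reflectLine z).re = -2 - z.re := by simp [reflectLine]

@[simp] lemma reflectLine_im (z : ℂ) : (reflectLine z).im = z.im := by simp [reflectLine]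

lemma continuous_reflectLine : Continuous reflectLine := by unfold reflectLine; fun_prop

lemma reflectLine_reflectLine (z : ℂ) : reflectLine (reflectLine z) = z := by
  apply Complex.ext <;> simp

lemma norm_reflectLine_sub (z w : ℂ) : ‖reflectLine z - reflectLine w‖ = ‖z - w‖ := by
  rw [reflectLine, reflectLine, sub_sub_sub_cancel_left, ← map_sub, norm_conj, norm_sub_rev]

lemma exp_neg_pi_mul_reflectLine (n : ℕ) (z : ℂ) :
    exp (-(I * Real.pi * (2 ^ n * reflectLine z))) = conj (exp (-(I * Real.pi * (2 ^ n * z)))) := by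
  rw [← exp_conj, exp_eq_exp_iff_exists_int]
  refine ⟨2 ^ n, ?_⟩
  simp [reflectLine, map_ofNat]
  ring

/-- The solution of `2 g = ext f ∘ P` on the closed upper half-plane, where `ext f` is the extension
of `f` to the lower half-plane by reflection. The polynomial folds the second quadrant onto the
lower half-plane, so the reflected branch is used there. -/
noncomputable def combLift (ξ : ℝ) (f : ℂ → ℂ) (z : ℂ) : ℂ :=
  if 0 ≤ z.re then f (quadFix ξ z) / 2 else reflectLine (f (conj (quadFix ξ z))) / 2

lemma quadFix_mem_closedUpper {z : ℂ} (hz : z ∈ closedUpper) (h : 0 ≤ z.re) :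
    quadFix ξ z ∈ closedUpper := by
  have hz' : 0 ≤ z.im := hz
  change 0 ≤ (quadFix ξ z).im
  rw [quadFix_im]; positivity

lemma conj_quadFix_mem_closedUpper {z : ℂ} (hz : z ∈ closedUpper) (h : z.re ≤ 0) :
    conj (quadFix ξ z) ∈ closedUpper := by
  have hz' : 0 ≤ z.im := hz
  change 0 ≤ (conj (quadFix ξ z)).im
  rw [conj_im, quadFix_im]; nlinarith

/-- The properties of a map from the closed upper half-plane to a half-strip that are preserved by
the operator `combLift ξ`: the real points to the right of `ξ` and to the left of `-ξ` go to the two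
vertical sides. -/
structure IsStripMap (ξ : ℝ) (f : ℂ → ℂ) : Prop where
  continuousOn : ContinuousOn f closedUpper
  re_mem : ∀ z ∈ closedUpper, (f z).re ∈ Icc (-1) 0
  im_nonneg : ∀ z ∈ closedUpper, 0 ≤ (f z).im
  re_right : ∀ x : ℝ, ξ ≤ x → (f x).re = 0
  re_left : ∀ x : ℝ, x ≤ -ξ → (f x).re = -1

/-- On the imaginary axis both branches of `combLift` agree, so that the reflected branch may be
used on the whole closed second quadrant. -/
lemma IsStripMap.combLift_of_re_nonpos (hξ : 2 < ξ) {f : ℂ → ℂ} (hf : IsStripMap ξ f) {z : ℂ}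
    (h : z.re ≤ 0) : combLift ξ f z = reflectLine (f (conj (quadFix ξ z))) / 2 := by
  rw [combLift]
  split_ifs with h'
  · have h0 : z.re = 0 := le_antisymm h h'
    have him : (quadFix ξ z).im = 0 := by rw [quadFix_im, h0]; ring
    have hre : (quadFix ξ z).re ≤ -ξ := by
      rw [quadFix_re, h0]; nlinarith [sq_nonneg z.im]
    have hz : quadFix ξ z = ((quadFix ξ z).re : ℂ) := Complex.ext rfl (by simpa using him)
    have hf' := hf.re_left _ hre
    rw [← hz] at hf'
    rw [conj_eq_iff_im.2 him]
    congr 1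
    apply Complex.ext <;> simp [hf']
    norm_num
  · rfl

lemma IsStripMap.combLift (hξ : 2 < ξ) {f : ℂ → ℂ} (hf : IsStripMap ξ f) :
    IsStripMap ξ (combLift ξ f) := by
  refine ⟨?_, ?_, ?_, ?_, ?_⟩
  · have hsplit : closedUpper = (closedUpper ∩ {z | 0 ≤ z.re}) ∪ (closedUpper ∩ {z | z.re ≤ 0}) := by
      ext z
      simp only [mem_union, mem_inter_iff, mem_ofPred_eq]
      have := le_total 0 z.re
      tauto
    rw [hsplit]
    refine ContinuousOn.union_of_isClosed ?_ ?_
      (isClosed_closedUpper.inter (isClosed_le continuous_const continuous_re))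
      (isClosed_closedUpper.inter (isClosed_le continuous_re continuous_const))
    · have : ContinuousOn (fun z => f (quadFix ξ z) / 2) (closedUpper ∩ {z | 0 ≤ z.re}) :=
        (hf.continuousOn.comp continuous_quadFix.continuousOn
          fun z hz => quadFix_mem_closedUpper hz.1 hz.2).div_const 2
      exact this.congr fun z hz => if_pos (show 0 ≤ z.re from hz.2)
    · have : ContinuousOn (fun z => reflectLine (f (conj (quadFix ξ z))) / 2)
          (closedUpper ∩ {z | z.re ≤ 0}) :=
        (continuous_reflectLine.comp_continuousOn (hf.continuousOn.comp
          (continuous_conj.comp continuous_quadFix).continuousOn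
          fun z hz => conj_quadFix_mem_closedUpper hz.1 hz.2)).div_const 2
      exact this.congr fun z hz => hf.combLift_of_re_nonpos hξ hz.2
  · intro z hz
    rw [_root_.combLift]
    split_ifs with h
    · have := hf.re_mem _ (quadFix_mem_closedUpper (ξ := ξ) hz h)
      simp only [div_ofNat_re, mem_Icc] at this ⊢
      constructor <;> linarith [this.1, this.2]
    · have := hf.re_mem _ (conj_quadFix_mem_closedUpper (ξ := ξ) hz (not_le.1 h).le)
      simp only [div_ofNat_re, reflectLine_re, mem_Icc] at this ⊢
      constructor <;> linarith [this.1, this.2]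
  · intro z hz
    rw [_root_.combLift]
    split_ifs with h
    · have := hf.im_nonneg _ (quadFix_mem_closedUpper (ξ := ξ) hz h)
      simp only [div_ofNat_im]; linarith
    · have := hf.im_nonneg _ (conj_quadFix_mem_closedUpper (ξ := ξ) hz (not_le.1 h).le)
      simp only [div_ofNat_im, reflectLine_im]; linarith
  · intro x hx
    rw [_root_.combLift, if_pos (by simp; linarith), quadFix_ofReal, div_ofNat_re,
      hf.re_right _ (by nlinarith)]
    norm_num
  · intro x hx
    rw [_root_.combLift, if_neg (by simp; linarith), quadFix_ofReal, conj_ofReal, div_ofNat_re,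
      reflectLine_re, hf.re_right _ (by nlinarith)]
    norm_num

/-- The argument of the logarithm in `combSeed`: equal to `z` for `‖z‖ ≥ ξ`, and moved away from `0`
for small `z`. -/
noncomputable def seedArg (ξ : ℝ) (z : ℂ) : ℂ := z + I * (max (ξ - ‖z‖) 0 : ℝ)

/-- The first approximation `(i / π) log z` of the comb map, modified near `0` so that it becomes
continuous on the closed upper half-plane. -/
noncomputable def combSeed (ξ : ℝ) (z : ℂ) : ℂ :=
  I / Real.pi * log (-I * seedArg ξ z) - 1 / 2

lemma seedArg_of_le {z : ℂ} (hz : ξ ≤ ‖z‖) : seedArg ξ z = z := by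
  rw [seedArg, max_eq_right (by linarith)]; simp

lemma seedArg_im (z : ℂ) : (seedArg ξ z).im = z.im + max (ξ - ‖z‖) 0 := by simp [seedArg]

lemma seedArg_re (z : ℂ) : (seedArg ξ z).re = z.re := by simp [seedArg]

lemma norm_seedArg_le (hξ : 2 < ξ) (z : ℂ) : ‖seedArg ξ z‖ ≤ ‖z‖ + ξ := by
  refine (norm_add_le _ _).trans (add_le_add le_rfl ?_)
  rw [norm_mul, norm_I, one_mul, norm_real, Real.norm_of_nonneg (le_max_right _ _)]
  exact max_le (by linarith [norm_nonneg z]) (by linarith)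

lemma norm_sq_add_sq_le_norm_seedArg {z : ℂ} (hz : z ∈ closedUpper) :
    ‖z‖ ^ 2 + max (ξ - ‖z‖) 0 ^ 2 ≤ ‖seedArg ξ z‖ ^ 2 := by
  rw [Complex.sq_norm (seedArg ξ z), normSq_apply, seedArg_im, seedArg_re, Complex.sq_norm,
    normSq_apply]
  have h1 : 0 ≤ z.im := hz
  have h2 := mul_nonneg h1 (le_max_right (ξ - ‖z‖) 0)
  nlinarith

lemma le_norm_seedArg {z : ℂ} (hz : z ∈ closedUpper) : ‖z‖ ≤ ‖seedArg ξ z‖ := by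
  apply le_of_sq_le_sq _ (norm_nonneg _)
  have := norm_sq_add_sq_le_norm_seedArg (ξ := ξ) hz
  nlinarith [sq_nonneg (max (ξ - ‖z‖) 0)]

lemma one_le_norm_seedArg (hξ : 2 < ξ) {z : ℂ} (hz : z ∈ closedUpper) : 1 ≤ ‖seedArg ξ z‖ := by
  apply le_of_sq_le_sq _ (norm_nonneg _)
  have := norm_sq_add_sq_le_norm_seedArg (ξ := ξ) hz
  have h1 := le_max_left (ξ - ‖z‖) 0
  have h2 : 4 ≤ (‖z‖ + max (ξ - ‖z‖) 0) ^ 2 := by nlinarith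
  nlinarith [sq_nonneg (‖z‖ - max (ξ - ‖z‖) 0)]

lemma continuous_seedArg : Continuous (seedArg ξ) := by unfold seedArg; fun_prop

lemma neg_I_mul_seedArg_ne_zero (hξ : 2 < ξ) {z : ℂ} (hz : z ∈ closedUpper) :
    -I * seedArg ξ z ≠ 0 := by
  have := one_le_norm_seedArg hξ hz
  refine mul_ne_zero (neg_ne_zero.2 I_ne_zero) fun h => ?_
  rw [h] at this; simp at this; linarith

lemma re_neg_I_mul_seedArg {z : ℂ} (hz : z ∈ closedUpper) :
    0 ≤ (-I * seedArg ξ z).re := by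
  have h1 : 0 ≤ z.im := hz
  have : (-I * seedArg ξ z).re = z.im + max (ξ - ‖z‖) 0 := by simp [seedArg_im]
  rw [this]
  exact add_nonneg h1 (le_max_right _ _)

lemma combSeed_im (z : ℂ) : (combSeed ξ z).im = Real.log ‖seedArg ξ z‖ / Real.pi := by
  have : combSeed ξ z = (1 / Real.pi : ℝ) * (I * log (-I * seedArg ξ z)) - (1 / 2 : ℝ) := by
    rw [combSeed]; push_cast; ring
  rw [this, sub_im, ofReal_im, im_ofReal_mul, I_mul_im, log_re, norm_mul, norm_neg, norm_I]
  ring_nf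

lemma combSeed_re (z : ℂ) : (combSeed ξ z).re = -arg (-I * seedArg ξ z) / Real.pi - 1 / 2 := by
  have : combSeed ξ z = (1 / Real.pi : ℝ) * (I * log (-I * seedArg ξ z)) - (1 / 2 : ℝ) := by
    rw [combSeed]; push_cast; ring
  rw [this, sub_re, ofReal_re, re_ofReal_mul, I_mul_re, log_im]
  ring

lemma exp_combSeed (hξ : 2 < ξ) {z : ℂ} (hz : z ∈ closedUpper) :
    exp (-(I * Real.pi * combSeed ξ z)) = seedArg ξ z := by
  have h : -(I * Real.pi * combSeed ξ z) = log (-I * seedArg ξ z) + Real.pi / 2 * I := by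
    have hpi : (Real.pi : ℂ) ≠ 0 := ofReal_ne_zero.2 Real.pi_ne_zero
    rw [combSeed]
    field_simp
    linear_combination (-2) * log (-(I * seedArg ξ z)) * I_sq
  rw [h, exp_add, exp_log (neg_I_mul_seedArg_ne_zero hξ hz), exp_pi_div_two_mul_I]
  linear_combination (-seedArg ξ z) * I_sq

lemma isStripMap_combSeed (hξ : 2 < ξ) : IsStripMap ξ (combSeed ξ) := by
  have hpi := Real.pi_pos
  refine ⟨?_, ?_, ?_, ?_, ?_⟩
  · have : ContinuousOn (fun z => log (-I * seedArg ξ z)) closedUpper := by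
      refine ContinuousOn.clog (by have := continuous_seedArg (ξ := ξ); fun_prop) fun z hz => ?_
      have h1 := re_neg_I_mul_seedArg (ξ := ξ) hz
      have h2 := neg_I_mul_seedArg_ne_zero hξ hz
      rw [mem_slitPlane_iff]
      rcases h1.lt_or_eq with h | h
      · exact Or.inl h
      · exact Or.inr fun h' => h2 (Complex.ext h.symm h')
    unfold combSeed
    fun_prop
  · intro z hz
    have h := abs_le.1 (abs_arg_le_pi_div_two_iff.2 (re_neg_I_mul_seedArg (ξ := ξ) hz))
    rw [combSeed_re]
    constructor
    · have : -(1 / 2) ≤ -arg (-I * seedArg ξ z) / Real.pi := by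
        rw [le_div_iff₀ hpi]; linarith
      linarith
    · have : -arg (-I * seedArg ξ z) / Real.pi ≤ 1 / 2 := by
        rw [div_le_iff₀ hpi]; linarith
      linarith
  · intro z hz
    rw [combSeed_im]
    exact div_nonneg (Real.log_nonneg (one_le_norm_seedArg hξ hz)) hpi.le
  · intro x hx
    have : -I * seedArg ξ x = (x : ℝ) * (-I) := by
      rw [seedArg_of_le (by rw [norm_real, Real.norm_of_nonneg] <;> linarith)]; ring
    rw [combSeed_re, this, arg_real_mul _ (by linarith), arg_neg_I]
    field_simp; norm_num
  · intro x hx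
    have : -I * seedArg ξ x = (-x : ℝ) * I := by
      rw [seedArg_of_le (by rw [norm_real, Real.norm_of_nonpos] <;> linarith)]; push_cast; ring
    rw [combSeed_re, this, arg_real_mul _ (by linarith), arg_I]
    field_simp; norm_num

/-- The operator `combLift` halves distances. -/
lemma norm_combLift_sub_le {f g : ℂ → ℂ} {C : ℝ} (h : ∀ z ∈ closedUpper, ‖f z - g z‖ ≤ C) {z : ℂ}
    (hz : z ∈ closedUpper) : ‖combLift ξ f z - combLift ξ g z‖ ≤ C / 2 := by
  rw [combLift, combLift]
  split_ifs with h'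
  · rw [← sub_div, norm_div, Complex.norm_ofNat]
    exact div_le_div_of_nonneg_right (h _ (quadFix_mem_closedUpper hz h')) (by norm_num)
  · rw [← sub_div, norm_div, Complex.norm_ofNat, norm_reflectLine_sub]
    exact div_le_div_of_nonneg_right (h _ (conj_quadFix_mem_closedUpper hz (not_le.1 h').le))
      (by norm_num)

/-- The seed and its pull-back differ by a bounded amount, because `‖P z‖` is comparable to `‖z‖ ^ 2`
near infinity. -/
lemma exists_norm_combLift_combSeed_sub_le (hξ : 2 < ξ) :
    ∃ C, ∀ z ∈ closedUpper, ‖combLift ξ (combSeed ξ) z - combSeed ξ z‖ ≤ C := by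
  have hpi := Real.pi_pos
  set K : ℝ := 2 + 4 * ξ ^ 2 with hK
  have hK1 : 1 ≤ K := by nlinarith
  refine ⟨1 + Real.log K / Real.pi, fun z hz => ?_⟩
  have hS := isStripMap_combSeed hξ
  refine (norm_le_abs_re_add_abs_im _).trans (add_le_add ?_ ?_)
  · have h1 := (hS.combLift hξ).re_mem z hz
    have h2 := hS.re_mem z hz
    rw [sub_re, abs_le]
    constructor <;> linarith [h1.1, h1.2, h2.1, h2.2]
  · obtain ⟨w, hw, hwn, him⟩ : ∃ w ∈ closedUpper, ‖w‖ = ‖quadFix ξ z‖ ∧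
        (combLift ξ (combSeed ξ) z).im = (combSeed ξ w).im / 2 := by
      rw [combLift]
      split_ifs with h
      · exact ⟨_, quadFix_mem_closedUpper hz h, rfl, by simp⟩
      · exact ⟨_, conj_quadFix_mem_closedUpper hz (not_le.1 h).le, norm_conj _, by simp⟩
    have hu1 := one_le_norm_seedArg hξ hz
    have hv1 := one_le_norm_seedArg hξ hw
    have hu2 := le_norm_seedArg (ξ := ξ) hz
    have hv2 := le_norm_seedArg (ξ := ξ) hw
    have hu3 := norm_seedArg_le hξ z
    have hv3 := norm_seedArg_le hξ w
    have hn1 : ‖quadFix ξ z‖ ≤ ‖z ^ 2‖ + ‖((ξ ^ 2 - ξ : ℝ) : ℂ)‖ := norm_sub_le _ _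
    have hn2 : ‖z ^ 2‖ - ‖((ξ ^ 2 - ξ : ℝ) : ℂ)‖ ≤ ‖quadFix ξ z‖ := norm_sub_norm_le _ _
    rw [norm_pow, norm_real, Real.norm_of_nonneg (by nlinarith), ← hwn] at hn1 hn2
    rw [sub_im, him, combSeed_im, combSeed_im]
    set u := ‖seedArg ξ z‖
    set v := ‖seedArg ξ w‖
    have hzu : ‖z‖ ^ 2 ≤ u ^ 2 := by gcongr
    have hu : 1 ≤ u ^ 2 := by nlinarith
    have huv : v ≤ K * u ^ 2 := by nlinarith [mul_le_mul_of_nonneg_left hu (sq_nonneg ξ)]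
    have hvu : u ^ 2 ≤ K * v := by nlinarith [norm_nonneg z, sq_nonneg (‖z‖ - ξ)]
    have h1 : Real.log v ≤ Real.log K + 2 * Real.log u := by
      have := Real.log_le_log (by linarith) huv
      rwa [Real.log_mul (by linarith) (by positivity), Real.log_pow, Nat.cast_ofNat] at this
    have h2 : 2 * Real.log u ≤ Real.log K + Real.log v := by
      have := Real.log_le_log (by positivity) hvu
      rwa [Real.log_mul (by linarith) (by linarith), Real.log_pow, Nat.cast_ofNat] at this
    have h3 : 0 ≤ Real.log K := Real.log_nonneg hK1
    rw [div_right_comm, ← sub_div, abs_div, abs_of_pos hpi]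
    apply div_le_div_of_nonneg_right _ hpi.le
    rw [abs_le]
    constructor <;> linarith

/-- The approximations of the comb map: the iterated pull-backs of `combSeed`. -/
noncomputable def combApprox (ξ : ℝ) (n : ℕ) : ℂ → ℂ := (combLift ξ)^[n] (combSeed ξ)

/-- The comb map of the polynomial with fixed point `ξ`, before the rescaling of the half-plane. -/
noncomputable def combLimit (ξ : ℝ) (z : ℂ) : ℂ := limUnder atTop fun n => combApprox ξ n z

lemma combApprox_succ (n : ℕ) : combApprox ξ (n + 1) = combLift ξ (combApprox ξ n) :=
  Function.iterate_succ_apply' _ _ _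

lemma isStripMap_combApprox (hξ : 2 < ξ) (n : ℕ) : IsStripMap ξ (combApprox ξ n) := by
  induction n with
  | zero => exact isStripMap_combSeed hξ
  | succ n ih => rw [combApprox_succ]; exact ih.combLift hξ

/-- The approximations converge uniformly on the closed half-plane. -/
lemma exists_norm_combApprox_sub_le (hξ : 2 < ξ) : ∃ C, ∀ z ∈ closedUpper,
    Tendsto (fun n => combApprox ξ n z) atTop (𝓝 (combLimit ξ z)) ∧
      ∀ n, ‖combApprox ξ n z - combLimit ξ z‖ ≤ C * (1 / 2) ^ n := by
  obtain ⟨C, hC⟩ := exists_norm_combLift_combSeed_sub_le hξ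
  have hstep : ∀ n, ∀ z ∈ closedUpper,
      ‖combApprox ξ (n + 1) z - combApprox ξ n z‖ ≤ C * (1 / 2) ^ n := by
    intro n
    induction n with
    | zero => intro z hz; simpa [combApprox] using hC z hz
    | succ n ih =>
      intro z hz
      rw [combApprox_succ (n + 1), combApprox_succ n]
      rw [combApprox_succ n] at ih
      refine (norm_combLift_sub_le ih hz).trans (le_of_eq ?_)
      rw [pow_succ]; ring
  refine ⟨2 * C, fun z hz => ?_⟩
  have hd : ∀ n, dist (combApprox ξ n z) (combApprox ξ (n + 1) z) ≤ C * (1 / 2) ^ n := fun n => by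
    rw [dist_comm, dist_eq_norm]; exact hstep n z hz
  have ht := (cauchySeq_of_le_geometric _ _ (by norm_num) hd).tendsto_limUnder
  refine ⟨ht, fun n => ?_⟩
  have := dist_le_of_le_geometric_of_tendsto _ _ (by norm_num) hd ht n
  rw [dist_eq_norm] at this
  refine this.trans (le_of_eq ?_)
  ring

lemma tendsto_combApprox (hξ : 2 < ξ) {z : ℂ} (hz : z ∈ closedUpper) :
    Tendsto (fun n => combApprox ξ n z) atTop (𝓝 (combLimit ξ z)) := by
  obtain ⟨C, hC⟩ := exists_norm_combApprox_sub_le hξ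
  exact (hC z hz).1

lemma tendstoUniformlyOn_combApprox (hξ : 2 < ξ) :
    TendstoUniformlyOn (combApprox ξ) (combLimit ξ) atTop closedUpper := by
  obtain ⟨C, hC⟩ := exists_norm_combApprox_sub_le hξ
  rw [Metric.tendstoUniformlyOn_iff]
  intro ε hε
  have h0 : Tendsto (fun n : ℕ => C * (1 / 2 : ℝ) ^ n) atTop (𝓝 (C * 0)) :=
    (tendsto_pow_atTop_nhds_zero_of_lt_one (by norm_num) (by norm_num)).const_mul C
  rw [mul_zero] at h0
  filter_upwards [h0.eventually (eventually_lt_nhds hε)] with n hn z hz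
  rw [dist_comm, dist_eq_norm]
  exact ((hC z hz).2 n).trans_lt hn

lemma isStripMap_combLimit (hξ : 2 < ξ) : IsStripMap ξ (combLimit ξ) := by
  have hre : ∀ {z}, z ∈ closedUpper →
      Tendsto (fun n => (combApprox ξ n z).re) atTop (𝓝 (combLimit ξ z).re) := fun hz =>
    (continuous_re.tendsto _).comp (tendsto_combApprox hξ hz)
  have him : ∀ {z}, z ∈ closedUpper →
      Tendsto (fun n => (combApprox ξ n z).im) atTop (𝓝 (combLimit ξ z).im) := fun hz =>
    (continuous_im.tendsto _).comp (tendsto_combApprox hξ hz)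
  refine ⟨?_, ?_, ?_, ?_, ?_⟩
  · exact (tendstoUniformlyOn_combApprox hξ).continuousOn
      (Eventually.frequently (Eventually.of_forall fun n => (isStripMap_combApprox hξ n).continuousOn))
  · exact fun z hz => isClosed_Icc.mem_of_tendsto (hre hz)
      (Eventually.of_forall fun n => (isStripMap_combApprox hξ n).re_mem z hz)
  · exact fun z hz => ge_of_tendsto' (him hz) fun n => (isStripMap_combApprox hξ n).im_nonneg z hz
  · intro x hx
    refine tendsto_nhds_unique (hre (ofReal_mem_closedUpper x)) ?_
    simp only [fun n => (isStripMap_combApprox hξ n).re_right x hx, tendsto_const_nhds]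
  · intro x hx
    refine tendsto_nhds_unique (hre (ofReal_mem_closedUpper x)) ?_
    simp only [fun n => (isStripMap_combApprox hξ n).re_left x hx, tendsto_const_nhds]

lemma combLift_combLimit (hξ : 2 < ξ) {z : ℂ} (hz : z ∈ closedUpper) :
    combLift ξ (combLimit ξ) z = combLimit ξ z := by
  have h1 : Tendsto (fun n => combApprox ξ (n + 1) z) atTop (𝓝 (combLimit ξ z)) :=
    (tendsto_combApprox hξ hz).comp (tendsto_add_atTop_nat 1)
  refine tendsto_nhds_unique ?_ h1
  simp only [combApprox_succ, combLift]
  split_ifs with h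
  · exact (tendsto_combApprox hξ (quadFix_mem_closedUpper hz h)).div_const 2
  · exact ((continuous_reflectLine.tendsto _).comp
      (tendsto_combApprox hξ (conj_quadFix_mem_closedUpper hz (not_le.1 h).le))).div_const 2

/-- The functional equation in the closed first quadrant. -/
lemma two_mul_combLimit_of_re_nonneg (hξ : 2 < ξ) {z : ℂ} (hz : z ∈ closedUpper) (h : 0 ≤ z.re) :
    2 * combLimit ξ z = combLimit ξ (quadFix ξ z) := by
  rw [← combLift_combLimit hξ hz, combLift, if_pos h]; ring

/-- The functional equation in the closed second quadrant. -/
lemma two_mul_combLimit_of_re_nonpos (hξ : 2 < ξ) {z : ℂ} (hz : z ∈ closedUpper) (h : z.re ≤ 0) :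
    2 * combLimit ξ z = reflectLine (combLimit ξ (conj (quadFix ξ z))) := by
  rw [← combLift_combLimit hξ hz, (isStripMap_combLimit hξ).combLift_of_re_nonpos hξ h]; ring

lemma tendsto_combLimit_cocompact (hξ : 2 < ξ) :
    Tendsto (combLimit ξ) (cocompact ℂ ⊓ 𝓟 closedUpper) (cocompact ℂ) := by
  obtain ⟨C, hC⟩ := exists_norm_combApprox_sub_le hξ
  rw [← Metric.cobounded_eq_cocompact, ← comap_norm_atTop (E := ℂ), tendsto_comap_iff]
  have hn : Tendsto (fun z : ℂ => ‖z‖) (comap norm atTop ⊓ 𝓟 closedUpper) atTop :=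
    tendsto_comap.mono_left inf_le_left
  have hlog : Tendsto (fun z : ℂ => Real.log ‖z‖ / Real.pi - C)
      (comap norm atTop ⊓ 𝓟 closedUpper) atTop :=
    tendsto_atTop_add_const_right _ _
      ((Real.tendsto_log_atTop.comp hn).atTop_div_const Real.pi_pos)
  refine tendsto_atTop_mono' _ ?_ hlog
  filter_upwards [hn.eventually (eventually_ge_atTop 1), mem_inf_of_right (mem_principal_self _)]
    with z hz1 hz
  have h1 := (hC z hz).2 0
  have h2 : Real.log ‖z‖ / Real.pi ≤ (combSeed ξ z).im := by
    rw [combSeed_im]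
    gcongr
    exact le_norm_seedArg hz
  have h3 : (combSeed ξ z).im ≤ ‖combSeed ξ z‖ := (le_abs_self _).trans (abs_im_le_norm _)
  have h4 : ‖combSeed ξ z‖ ≤ ‖combSeed ξ z - combLimit ξ z‖ + ‖combLimit ξ z‖ := by
    simpa using norm_add_le (combSeed ξ z - combLimit ξ z) (combLimit ξ z)
  have h5 : ‖combSeed ξ z - combLimit ξ z‖ ≤ C := by simpa [combApprox] using h1
  simp only [Function.comp_apply]
  linarith

/-! ### Holomorphy and injectivity in the upper half-plane -/

/-- A continuous logarithm of a holomorphic function is holomorphic. -/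
lemma hasDerivAt_of_exp_eventuallyEq {f F : ℂ → ℂ} {c z₀ F' : ℂ} (hc : c ≠ 0)
    (hf : ContinuousAt f z₀) (hF : HasDerivAt F F' z₀)
    (h : ∀ᶠ z in 𝓝 z₀, exp (c * f z) = F z) : HasDerivAt f (1 / c * (F' / F z₀)) z₀ := by
  have h0 : exp (c * f z₀) = F z₀ := h.self_of_nhds
  have hne : F z₀ ≠ 0 := h0 ▸ exp_ne_zero _
  have hcont : Tendsto (fun z => (c * (f z - f z₀)).im) (𝓝 z₀) (𝓝 0) := by
    have : ContinuousAt (fun z => (c * (f z - f z₀)).im) z₀ :=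
      continuous_im.continuousAt.comp (by fun_prop)
    simpa [ContinuousAt] using this
  have hev : f =ᶠ[𝓝 z₀] fun z => f z₀ + 1 / c * log (F z / F z₀) := by
    filter_upwards [h, hcont.eventually (Ioo_mem_nhds (neg_lt_zero.2 Real.pi_pos) Real.pi_pos)]
      with z hz him
    rw [← hz, ← h0, ← exp_sub, ← mul_sub, log_exp him.1 him.2.le]
    field_simp
    ring
  have hd : HasDerivAt (fun z => F z / F z₀) (F' / F z₀) z₀ := hF.div_const _
  have hl := (hd.clog (by rw [div_self hne]; exact one_mem_slitPlane)).const_mul (1 / c)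
  rw [div_self hne, div_one] at hl
  exact (hl.const_add (f z₀)).congr_of_eventuallyEq hev

lemma exp_combApprox (hξ : 2 < ξ) (n : ℕ) {z : ℂ} (hz : z ∈ closedUpper)
    (hn : ξ ≤ ‖(quadFix ξ)^[n] z‖) :
    exp (-(I * Real.pi * (2 ^ n * combApprox ξ n z))) = (quadFix ξ)^[n] z := by
  induction n generalizing z with
  | zero =>
    have := exp_combSeed hξ hz
    rw [seedArg_of_le (by simpa using hn)] at this
    simpa [combApprox] using this
  | succ n ih =>
    rw [Function.iterate_succ_apply] at hn ⊢
    rw [combApprox_succ, combLift]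
    split_ifs with h
    · rw [← ih (quadFix_mem_closedUpper hz h) hn]
      congr 1; ring
    · have h1 := conj_quadFix_mem_closedUpper (ξ := ξ) hz (not_le.1 h).le
      have h2 := ih h1 (by rwa [iterate_quadFix_conj, norm_conj])
      rw [iterate_quadFix_conj] at h2
      rw [← conj_conj ((quadFix ξ)^[n] (quadFix ξ z)), ← h2, ← exp_neg_pi_mul_reflectLine]
      congr 1; ring

/-- The points of the upper half-plane whose orbit has left the disk of radius `ξ` at time `n`. -/
def escapeSet (ξ : ℝ) (n : ℕ) : Set ℂ := {z | z ∈ openUpper ∧ ξ < ‖(quadFix ξ)^[n] z‖}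

lemma isOpen_escapeSet (n : ℕ) : IsOpen (escapeSet ξ n) :=
  isOpen_openUpper.inter
    (isOpen_lt continuous_const (continuous_quadFix.iterate n).norm)

lemma escapeSet_mono (hξ : 2 < ξ) {m n : ℕ} (h : m ≤ n) : escapeSet ξ m ⊆ escapeSet ξ n :=
  fun _ hz => ⟨hz.1, lt_norm_iterate_quadFix_of_le hξ h hz.2⟩

lemma exists_mem_escapeSet (hξ : 2 < ξ) {z : ℂ} (hz : z ∈ openUpper) : ∃ n, z ∈ escapeSet ξ n := by
  obtain ⟨n, hn⟩ := exists_lt_norm_iterate_of_im_ne_zero hξ (ne_of_gt (show 0 < z.im from hz))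
  exact ⟨n, hz, hn⟩

lemma hasDerivAt_combApprox (hξ : 2 < ξ) {n : ℕ} {z : ℂ} (hz : z ∈ escapeSet ξ n) :
    HasDerivAt (combApprox ξ n)
      (1 / (-(I * Real.pi * 2 ^ n)) * (deriv (quadFix ξ)^[n] z / (quadFix ξ)^[n] z)) z := by
  have hpi : (Real.pi : ℂ) ≠ 0 := ofReal_ne_zero.2 Real.pi_ne_zero
  refine hasDerivAt_of_exp_eventuallyEq
    (neg_ne_zero.2 (mul_ne_zero (mul_ne_zero I_ne_zero hpi) (by norm_num))) ?_
    ((differentiable_quadFix.iterate n) z).hasDerivAt ?_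
  · exact (isStripMap_combApprox hξ n).continuousOn.continuousAt
      (mem_of_superset (isOpen_openUpper.mem_nhds hz.1) openUpper_subset_closedUpper)
  · filter_upwards [(isOpen_escapeSet n).mem_nhds hz] with w hw
    rw [← exp_combApprox hξ n (openUpper_subset_closedUpper hw.1) hw.2.le]
    congr 1; ring

lemma tendstoLocallyUniformlyOn_combApprox (hξ : 2 < ξ) (n : ℕ) :
    TendstoLocallyUniformlyOn (combApprox ξ) (combLimit ξ) atTop (escapeSet ξ n) ∧
      ∀ᶠ k in atTop, DifferentiableOn ℂ (combApprox ξ k) (escapeSet ξ n) := by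
  refine ⟨((tendstoUniformlyOn_combApprox hξ).mono
    fun z hz => openUpper_subset_closedUpper hz.1).tendstoLocallyUniformlyOn, ?_⟩
  filter_upwards [eventually_ge_atTop n] with k hk z hz
  exact (hasDerivAt_combApprox hξ
    (escapeSet_mono hξ hk hz)).differentiableAt.differentiableWithinAt

lemma differentiableOn_combLimit (hξ : 2 < ξ) : DifferentiableOn ℂ (combLimit ξ) openUpper := by
  intro z hz
  obtain ⟨n, hn⟩ := exists_mem_escapeSet hξ hz
  obtain ⟨h1, h2⟩ := tendstoLocallyUniformlyOn_combApprox hξ n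
  exact ((h1.differentiableOn h2 (isOpen_escapeSet n)).differentiableAt
    ((isOpen_escapeSet n).mem_nhds hn)).differentiableWithinAt

lemma differentiableAt_combLimit (hξ : 2 < ξ) {z : ℂ} (hz : z ∈ openUpper) :
    DifferentiableAt ℂ (combLimit ξ) z :=
  (differentiableOn_combLimit hξ).differentiableAt (isOpen_openUpper.mem_nhds hz)

/-- The derivative `(i / π) ∫ dμ(t) / (z - t)` of the comb map (with `μ` the equilibrium measure of
the Julia set) has positive real part. -/
lemma re_deriv_combLimit_pos (hξ : 2 < ξ) {z : ℂ} (hz : z ∈ openUpper) :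
    0 < (deriv (combLimit ξ) z).re := by
  have hpi := Real.pi_pos
  have hz' : 0 < z.im := hz
  obtain ⟨n, hn⟩ := exists_mem_escapeSet hξ hz
  obtain ⟨h1, h2⟩ := tendstoLocallyUniformlyOn_combApprox hξ n
  have ht := (h1.deriv h2 (isOpen_escapeSet n)).tendsto_at hn
  have hb : z.im / (‖z‖ + ξ) ^ 2 / Real.pi ≤ (deriv (combLimit ξ) z).re := by
    refine ge_of_tendsto ((continuous_re.tendsto _).comp ht) ?_
    filter_upwards [eventually_ge_atTop n] with k hk
    have hd := (hasDerivAt_combApprox hξ (escapeSet_mono hξ hk hn)).deriv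
    have hl := (logDeriv_iterate_quadFix hξ hz' k (s := 0) ⟨by linarith, by linarith⟩).2
    rw [ofReal_zero, sub_zero] at hl
    set w := deriv (quadFix ξ)^[k] z / (quadFix ξ)^[k] z
    have hw : 1 / (-(I * Real.pi * 2 ^ k)) * w = (1 / (Real.pi * 2 ^ k) : ℝ) * (I * w) := by
      have hpi' : (Real.pi : ℂ) ≠ 0 := ofReal_ne_zero.2 Real.pi_ne_zero
      push_cast
      field_simp
      linear_combination (-w) * I_sq
    simp only [Function.comp_apply]
    rw [hd, hw, re_ofReal_mul, I_mul_re, div_le_iff₀ hpi]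
    have h2k : (0 : ℝ) < 2 ^ k := by positivity
    have : 1 / (Real.pi * 2 ^ k) * -w.im * Real.pi = -w.im / 2 ^ k := by field_simp
    rw [this, le_div_iff₀ h2k]
    linarith
  exact lt_of_lt_of_le (by positivity) hb

/-- The Noshiro–Warschawski theorem on the upper half-plane: a holomorphic function whose
derivative has positive real part is injective. -/
lemma injOn_openUpper_of_re_deriv_pos {f : ℂ → ℂ}
    (hf : ∀ z ∈ openUpper, DifferentiableAt ℂ f z) (hpos : ∀ z ∈ openUpper, 0 < (deriv f z).re) :
    InjOn f openUpper := by
  intro z hz w hw hzw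
  by_contra hne
  have hz' : 0 < z.im := hz
  have hw' : 0 < w.im := hw
  have hd : w - z ≠ 0 := sub_ne_zero.2 (Ne.symm hne)
  have hmem : ∀ t ∈ Icc (0 : ℝ) 1, z + t * (w - z) ∈ openUpper := by
    intro t ht
    change 0 < (z + t * (w - z)).im
    rw [add_im, im_ofReal_mul, sub_im]
    rcases ht.1.eq_or_lt with rfl | h
    · simpa using hz'
    · nlinarith [ht.2, mul_pos h hw']
  have hderiv : ∀ t ∈ Icc (0 : ℝ) 1,
      HasDerivAt (fun t : ℝ => (f (z + t * (w - z)) / (w - z)).re)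
        (deriv f (z + t * (w - z))).re t := by
    intro t ht
    have h1 : HasDerivAt (fun s : ℂ => z + s * (w - z)) (w - z) (t : ℂ) := by
      simpa using ((hasDerivAt_id (t : ℂ)).mul_const (w - z)).const_add z
    have h2 := ((hf _ (hmem t ht)).hasDerivAt.comp (t : ℂ) h1).div_const (w - z)
    rw [mul_div_assoc, div_self hd, mul_one] at h2
    exact h2.real_of_complex
  obtain ⟨t, ht, h0⟩ := exists_hasDerivAt_eq_zero (zero_lt_one (α := ℝ))
    (fun t ht => (hderiv t ht).continuousAt.continuousWithinAt) (by simp [hzw])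
    (fun t ht => hderiv t (Ioo_subset_Icc_self ht))
  exact (hpos _ (hmem t (Ioo_subset_Icc_self ht))).ne' h0

lemma injOn_combLimit (hξ : 2 < ξ) : InjOn (combLimit ξ) openUpper :=
  injOn_openUpper_of_re_deriv_pos (fun _ hz => differentiableAt_combLimit hξ hz)
    fun _ hz => re_deriv_combLimit_pos hξ hz

lemma deriv_combLimit_ne_zero (hξ : 2 < ξ) {z : ℂ} (hz : z ∈ openUpper) :
    deriv (combLimit ξ) z ≠ 0 := by
  intro h
  have := re_deriv_combLimit_pos hξ hz
  rw [h] at this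
  simp at this

lemma isOpen_image_combLimit (hξ : 2 < ξ) : IsOpen (combLimit ξ '' openUpper) := by
  rw [isOpen_iff_mem_nhds]
  rintro _ ⟨z, hz, rfl⟩
  have ha : AnalyticAt ℂ (combLimit ξ) z :=
    (differentiableOn_combLimit hξ).analyticAt (isOpen_openUpper.mem_nhds hz)
  rw [← ha.hasStrictDerivAt.map_nhds_eq (deriv_combLimit_ne_zero hξ hz)]
  exact image_mem_map (isOpen_openUpper.mem_nhds hz)

lemma combLimit_mem_strip (hξ : 2 < ξ) {z : ℂ} (hz : z ∈ openUpper) :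
    (combLimit ξ z).re ∈ Ioo (-1) 0 ∧ 0 < (combLimit ξ z).im := by
  have hs := isStripMap_combLimit hξ
  have hmem : combLimit ξ z ∈ combLimit ξ '' openUpper := mem_image_of_mem _ hz
  have hint : ∀ S : Set ℂ, (∀ w ∈ closedUpper, combLimit ξ w ∈ S) → combLimit ξ z ∈ interior S := by
    intro S hS
    refine interior_maximal ?_ (isOpen_image_combLimit hξ) hmem
    rintro _ ⟨w, hw, rfl⟩
    exact hS w (openUpper_subset_closedUpper hw)
  have h1 := hint {w | -1 ≤ w.re} fun w hw => (hs.re_mem w hw).1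
  have h2 := hint {w | w.re ≤ 0} fun w hw => (hs.re_mem w hw).2
  have h3 := hint {w | 0 ≤ w.im} fun w hw => hs.im_nonneg w hw
  rw [interior_setOfPred_le_re] at h1
  rw [interior_setOfPred_re_le] at h2
  rw [interior_setOfPred_le_im] at h3
  exact ⟨⟨h1, h2⟩, h3⟩

/-! ### Boundary values on the real axis -/

lemma two_mul_re (z : ℂ) : (2 * z).re = 2 * z.re := by simp

lemma two_mul_im (z : ℂ) : (2 * z).im = 2 * z.im := by simp

lemma log_norm_iterate_quadFix (hξ : 2 < ξ) (n : ℕ) {z : ℂ} (hz : z ∈ closedUpper)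
    (hn : ξ ≤ ‖(quadFix ξ)^[n] z‖) :
    Real.log ‖(quadFix ξ)^[n] z‖ = 2 ^ n * (Real.pi * (combApprox ξ n z).im) := by
  have : -(I * Real.pi * (2 ^ n * combApprox ξ n z))
      = ((-(Real.pi * 2 ^ n) : ℝ) : ℂ) * (I * combApprox ξ n z) := by push_cast; ring
  rw [← exp_combApprox hξ n hz hn, norm_exp, Real.log_exp, this, re_ofReal_mul, I_mul_re]
  ring

/-- Comparison of the Green function `π Im θ` at two points. -/
lemma combLimit_im_add_le (hξ : 2 < ξ) {z w : ℂ} {q : ℝ} (hz : z ∈ closedUpper)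
    (hw : w ∈ closedUpper) (hwξ : ξ ≤ ‖w‖) (hq : 1 ≤ q)
    (h : ∀ s ∈ Icc (-ξ) ξ, q * ‖w - s‖ ≤ ‖z - s‖) :
    (combLimit ξ w).im + Real.log q / Real.pi ≤ (combLimit ξ z).im := by
  have hpi := Real.pi_pos
  have him : ∀ {z}, z ∈ closedUpper →
      Tendsto (fun n => (combApprox ξ n z).im) atTop (𝓝 (combLimit ξ z).im) := fun hz =>
    (continuous_im.tendsto _).comp (tendsto_combApprox hξ hz)
  refine le_of_tendsto_of_tendsto' ((him hw).add_const _) (him hz) fun n => ?_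
  have hwn : ξ ≤ ‖(quadFix ξ)^[n] w‖ := by
    have := le_norm_iterate_quadFix hξ hwξ n
    have : 0 ≤ 2 ^ n * (‖w‖ - ξ) := mul_nonneg (by positivity) (by linarith)
    linarith
  have hqn : 1 ≤ q ^ (2 ^ n) := one_le_pow₀ hq
  have hcmp : q ^ (2 ^ n) * ‖(quadFix ξ)^[n] w‖ ≤ ‖(quadFix ξ)^[n] z‖ := by
    simpa using pow_mul_norm_iterate_sub_le hξ (by linarith) h n (s := 0)
      ⟨by linarith, by linarith⟩
  have hzn : ξ ≤ ‖(quadFix ξ)^[n] z‖ := by nlinarith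
  have hlog := Real.log_le_log (by nlinarith) hcmp
  rw [Real.log_mul (by positivity) (by linarith), Real.log_pow,
    log_norm_iterate_quadFix hξ n hz hzn,
    log_norm_iterate_quadFix hξ n hw hwn] at hlog
  push_cast at hlog
  rw [← mul_add] at hlog
  have := le_of_mul_le_mul_left hlog (by positivity)
  rw [← le_sub_iff_add_le', div_le_iff₀ hpi]
  linarith

/-- The comb map commutes with the reflections in the imaginary axis and in the line
`Re = -1 / 2`. -/
lemma combLimit_neg_conj (hξ : 2 < ξ) {z : ℂ} (hz : z ∈ closedUpper) :
    combLimit ξ (-conj z) = -1 - conj (combLimit ξ z) := by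
  have hz' : -conj z ∈ closedUpper := by
    change 0 ≤ (-conj z).im
    simpa using show 0 ≤ z.im from hz
  have aux : ∀ w ∈ closedUpper, -conj w ∈ closedUpper → 0 ≤ w.re →
      combLimit ξ (-conj w) = -1 - conj (combLimit ξ w) := by
    intro w hw hw' h
    have h1 := two_mul_combLimit_of_re_nonneg hξ hw h
    have h2 := two_mul_combLimit_of_re_nonpos hξ hw' (by simpa using h)
    rw [quadFix_neg, quadFix_conj, conj_conj, ← h1, reflectLine, map_mul, map_ofNat] at h2
    linear_combination h2 / 2
  rcases le_total 0 z.re with h | h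
  · exact aux z hz hz' h
  · have := aux (-conj z) hz' (by simpa using hz) (by simpa using h)
    simp only [map_neg, conj_conj, neg_neg] at this
    rw [this]
    simp

lemma combLimit_neg_ofReal (hξ : 2 < ξ) (x : ℝ) :
    combLimit ξ (-x) = -1 - conj (combLimit ξ x) := by
  simpa using combLimit_neg_conj hξ (ofReal_mem_closedUpper x)

lemma combLimit_neg_ofReal_re (hξ : 2 < ξ) (x : ℝ) :
    (combLimit ξ ((-x : ℝ) : ℂ)).re = -1 - (combLimit ξ x).re := by
  rw [ofReal_neg, combLimit_neg_ofReal hξ]; simp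

lemma combLimit_neg_ofReal_im (hξ : 2 < ξ) (x : ℝ) :
    (combLimit ξ ((-x : ℝ) : ℂ)).im = (combLimit ξ x).im := by
  rw [ofReal_neg, combLimit_neg_ofReal hξ]; simp

lemma combLimit_im_strictMonoOn (hξ : 2 < ξ) :
    StrictMonoOn (fun x : ℝ => (combLimit ξ x).im) (Ici ξ) := by
  intro u hu x hx hux
  have hu' : ξ ≤ u := hu
  have hq : 1 < (x + ξ) / (u + ξ) := by rw [one_lt_div (by linarith)]; linarith
  have := combLimit_im_add_le hξ (z := x) (w := u) (ofReal_mem_closedUpper x)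
    (ofReal_mem_closedUpper u) (by rw [norm_real, Real.norm_of_nonneg] <;> linarith) hq.le ?_
  · have h2 : 0 < Real.log ((x + ξ) / (u + ξ)) / Real.pi :=
      div_pos (Real.log_pos hq) Real.pi_pos
    change (combLimit ξ u).im < (combLimit ξ x).im
    linarith
  · intro s hs
    rw [← ofReal_sub, ← ofReal_sub, norm_real, norm_real, Real.norm_of_nonneg (by linarith [hs.2]),
      Real.norm_of_nonneg (by linarith [hs.2]), div_mul_eq_mul_div, div_le_iff₀ (by linarith)]
    nlinarith [hs.1]

lemma combLimit_im_strictAntiOn (hξ : 2 < ξ) :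
    StrictAntiOn (fun x : ℝ => (combLimit ξ x).im) (Iic (-ξ)) := by
  intro x hx u hu hxu
  have hx' : x ≤ -ξ := hx
  have hu' : u ≤ -ξ := hu
  have := combLimit_im_strictMonoOn hξ (show -u ∈ Ici ξ from by simp; linarith)
    (show -x ∈ Ici ξ from by simp; linarith) (neg_lt_neg hxu)
  simpa only [combLimit_neg_ofReal_im hξ] using this

lemma two_mul_combLimit_ofReal_of_nonneg (hξ : 2 < ξ) {x : ℝ} (hx : 0 ≤ x) :
    2 * combLimit ξ x = combLimit ξ ((x ^ 2 - (ξ ^ 2 - ξ) : ℝ) : ℂ) := by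
  rw [two_mul_combLimit_of_re_nonneg hξ (ofReal_mem_closedUpper x) (by simpa using hx),
    quadFix_ofReal]

lemma two_mul_combLimit_ofReal_of_nonpos (hξ : 2 < ξ) {x : ℝ} (hx : x ≤ 0) :
    2 * combLimit ξ x = reflectLine (combLimit ξ ((x ^ 2 - (ξ ^ 2 - ξ) : ℝ) : ℂ)) := by
  rw [two_mul_combLimit_of_re_nonpos hξ (ofReal_mem_closedUpper x) (by simpa using hx),
    quadFix_ofReal, conj_ofReal]

lemma two_mul_combLimit_ofReal_im (hξ : 2 < ξ) (x : ℝ) :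
    2 * (combLimit ξ x).im = (combLimit ξ ((x ^ 2 - (ξ ^ 2 - ξ) : ℝ) : ℂ)).im := by
  rcases le_total 0 x with h | h
  · simpa using congrArg im (two_mul_combLimit_ofReal_of_nonneg hξ h)
  · simpa using congrArg im (two_mul_combLimit_ofReal_of_nonpos hξ h)

lemma combLimit_fixedPoint (hξ : 2 < ξ) : combLimit ξ ξ = 0 := by
  have h := two_mul_combLimit_ofReal_of_nonneg hξ (show 0 ≤ ξ by linarith)
  rw [show ξ ^ 2 - (ξ ^ 2 - ξ) = ξ by ring] at h
  linear_combination h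

lemma combLimit_neg_fixedPoint (hξ : 2 < ξ) : combLimit ξ (-ξ) = -1 := by
  rw [combLimit_neg_ofReal hξ, combLimit_fixedPoint hξ]; simp

/-- If the real part vanishes at a real point to the left of the repelling fixed point `ξ`, then its
orbit stays positive and yet moves away from `ξ` exponentially, which is impossible. -/
lemma combLimit_ofReal_re_eq_zero_iff (hξ : 2 < ξ) {x : ℝ} : (combLimit ξ x).re = 0 ↔ ξ ≤ x := by
  refine ⟨fun h0 => ?_, (isStripMap_combLimit hξ).re_right x⟩
  by_contra! hx
  have hpos : ∀ y : ℝ, (combLimit ξ y).re = 0 → 0 < y := by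
    intro y hy
    by_contra! h
    have h1 := congrArg re (two_mul_combLimit_ofReal_of_nonpos hξ h)
    have h2 := ((isStripMap_combLimit hξ).re_mem _
      (ofReal_mem_closedUpper (y ^ 2 - (ξ ^ 2 - ξ)))).1
    simp only [two_mul_re, reflectLine_re, hy] at h1
    linarith
  have key : ∀ n : ℕ, ∀ y : ℝ, (combLimit ξ y).re = 0 → y < ξ → 2 ^ n * (ξ - y) < ξ := by
    intro n
    induction n with
    | zero => intro y hy _; have := hpos y hy; simpa using this
    | succ n ih =>
      intro y hy hyξ
      have hy0 := hpos y hy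
      have h1 := congrArg re (two_mul_combLimit_ofReal_of_nonneg hξ hy0.le)
      rw [two_mul_re, hy, mul_zero] at h1
      have h2 := ih _ h1.symm (by nlinarith)
      have h3 : 2 * (ξ - y) ≤ ξ - (y ^ 2 - (ξ ^ 2 - ξ)) := by nlinarith
      have h4 := mul_le_mul_of_nonneg_left h3 (show (0 : ℝ) ≤ 2 ^ n by positivity)
      rw [pow_succ]
      linarith
  have ht : Tendsto (fun n : ℕ => (2 : ℝ) ^ n * (ξ - x)) atTop atTop :=
    (tendsto_pow_atTop_atTop_of_one_lt one_lt_two).atTop_mul_const (by linarith)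
  obtain ⟨n, hn⟩ := (ht.eventually (eventually_ge_atTop ξ)).exists
  linarith [key n x h0 hx]

lemma combLimit_ofReal_re_eq_neg_one_iff (hξ : 2 < ξ) {x : ℝ} :
    (combLimit ξ x).re = -1 ↔ x ≤ -ξ := by
  have h1 := combLimit_ofReal_re_eq_zero_iff hξ (x := -x)
  rw [combLimit_neg_ofReal_re hξ] at h1
  constructor
  · intro h; have := h1.1 (by rw [h]; ring); linarith
  · intro h; have := h1.2 (by linarith); linarith

lemma combLimit_ofReal_im_pos (hξ : 2 < ξ) {x : ℝ} (hx : ξ < |x|) : 0 < (combLimit ξ x).im := by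
  have aux : ∀ y : ℝ, ξ < y → 0 < (combLimit ξ y).im := by
    intro y hy
    have := combLimit_im_strictMonoOn hξ self_mem_Ici hy.le hy
    simpa [combLimit_fixedPoint hξ] using this
  rcases lt_abs.1 hx with h | h
  · exact aux x h
  · rw [← combLimit_neg_ofReal_im hξ]; exact aux _ h

lemma iterate_quadFix_ofReal (x : ℝ) (n : ℕ) : ∃ y : ℝ, (quadFix ξ)^[n] (x : ℂ) = y := by
  induction n with
  | zero => exact ⟨x, rfl⟩
  | succ n ih =>
    obtain ⟨y, hy⟩ := ih
    exact ⟨_, by rw [Function.iterate_succ_apply', hy, quadFix_ofReal]⟩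

lemma combLimit_iterate_im (hξ : 2 < ξ) (x : ℝ) (n : ℕ) :
    (combLimit ξ ((quadFix ξ)^[n] x)).im = 2 ^ n * (combLimit ξ x).im := by
  induction n with
  | zero => simp
  | succ n ih =>
    obtain ⟨y, hy⟩ := iterate_quadFix_ofReal (ξ := ξ) x n
    rw [Function.iterate_succ_apply', hy, quadFix_ofReal, ← two_mul_combLimit_ofReal_im hξ, ← hy,
      ih, pow_succ]
    ring

/-- The Green function vanishes exactly on the points with bounded orbit. -/
lemma combLimit_im_eq_zero_iff (hξ : 2 < ξ) {z : ℂ} (hz : z ∈ closedUpper) :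
    (combLimit ξ z).im = 0 ↔ ∀ n, ‖(quadFix ξ)^[n] z‖ ≤ ξ := by
  rcases (show 0 ≤ z.im from hz).lt_or_eq with h | h
  · refine iff_of_false (combLimit_mem_strip hξ h).2.ne' ?_
    push Not
    exact exists_lt_norm_iterate_of_im_ne_zero hξ h.ne'
  obtain ⟨x, rfl⟩ : ∃ x : ℝ, z = x := ⟨z.re, Complex.ext rfl (by simpa using h.symm)⟩
  constructor
  · intro h0
    by_contra! hcon
    obtain ⟨n, hn⟩ := hcon
    obtain ⟨y, hy⟩ := iterate_quadFix_ofReal (ξ := ξ) x n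
    have h1 := combLimit_iterate_im hξ x n
    rw [hy, norm_real, Real.norm_eq_abs] at hn
    rw [h0, mul_zero, hy] at h1
    exact (combLimit_ofReal_im_pos hξ hn).ne' h1
  · intro hb
    have hcont : ContinuousOn (combLimit ξ) (closedUpper ∩ Metric.closedBall 0 ξ) :=
      (isStripMap_combLimit hξ).continuousOn.mono inter_subset_left
    obtain ⟨M, hM⟩ := ((isCompact_closedBall (0 : ℂ) ξ).inter_left
      isClosed_closedUpper).exists_bound_of_continuousOn hcont
    by_contra hne
    have hpos : 0 < (combLimit ξ x).im :=
      lt_of_le_of_ne ((isStripMap_combLimit hξ).im_nonneg _ hz) (Ne.symm hne)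
    have ht : Tendsto (fun n : ℕ => (2 : ℝ) ^ n * (combLimit ξ x).im) atTop atTop :=
      (tendsto_pow_atTop_atTop_of_one_lt one_lt_two).atTop_mul_const hpos
    obtain ⟨n, hn⟩ := (ht.eventually (eventually_gt_atTop M)).exists
    obtain ⟨y, hy⟩ := iterate_quadFix_ofReal (ξ := ξ) x n
    rw [← combLimit_iterate_im hξ x n] at hn
    have h2 := hM ((quadFix ξ)^[n] x)
      ⟨hy ▸ ofReal_mem_closedUpper y, by simpa using hb n⟩
    linarith [(le_abs_self _).trans (abs_im_le_norm (combLimit ξ ((quadFix ξ)^[n] x)))]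

/-! ### The image is the comb domain -/

lemma mem_vertical_segment_iff {x h : ℝ} (hh : 0 ≤ h) (w : ℂ) :
    w ∈ segment ℝ (x : ℂ) (x + h * I) ↔ w.re = x ∧ w.im ∈ Icc 0 h := by
  rw [segment_eq_image']
  constructor
  · rintro ⟨t, ht, rfl⟩
    have h1 := mul_nonneg ht.1 hh
    have h2 := mul_le_of_le_one_left hh ht.2
    simp [h1, h2]
  · rintro ⟨h1, h2, h3⟩
    rcases hh.eq_or_lt with rfl | hpos
    · exact ⟨0, ⟨le_rfl, zero_le_one⟩, Complex.ext (by simp [h1]) (by simp; linarith)⟩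
    · refine ⟨w.im / h, ⟨by positivity, (div_le_one hpos).2 h3⟩, Complex.ext ?_ ?_⟩
      · simp [h1]
      · simp; field_simp

lemma mem_combDomain_iff {a : ℝ} (ha : 0 < a) (w : ℂ) :
    w ∈ combDomain a ↔ w.re ∈ Ioo (-1) 0 ∧ 0 < w.im ∧
      ∀ m k : ℕ, 1 ≤ m → Odd k → k ≤ 2 ^ m → w.re = -(k : ℝ) / 2 ^ m → a / 2 ^ m < w.im := by
  have hseg : ∀ m k : ℕ, w ∈ segment ℝ (-(k : ℂ) / 2 ^ m) (-(k : ℂ) / 2 ^ m + (a : ℂ) / 2 ^ m * I) ↔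
      w.re = -(k : ℝ) / 2 ^ m ∧ w.im ∈ Icc 0 (a / 2 ^ m) := by
    intro m k
    rw [← mem_vertical_segment_iff (by positivity)]
    push_cast
    rfl
  simp only [combDomain, Set.mem_sdiff, mem_ofPred_eq, mem_iUnion, hseg]
  constructor
  · rintro ⟨⟨h1, h2⟩, h3⟩
    refine ⟨h1, h2, fun m k hm hk hkm hre => ?_⟩
    by_contra! hle
    exact h3 ⟨m, k, ⟨hm, hk, hkm⟩, hre, h2.le, hle⟩
  · rintro ⟨h1, h2, h3⟩
    refine ⟨⟨h1, h2⟩, ?_⟩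
    rintro ⟨m, k, ⟨hm, hk, hkm⟩, hre, h4⟩
    exact absurd h4.2 (not_le.2 (h3 m k hm hk hkm hre))

/-- The height of the comb attached to the polynomial with fixed point `ξ`: the value of the Green
function at the critical value, divided by `π`. -/
noncomputable def combHeight (ξ : ℝ) : ℝ := (combLimit ξ ((-(ξ ^ 2 - ξ) : ℝ) : ℂ)).im

lemma combHeight_pos (hξ : 2 < ξ) : 0 < combHeight ξ :=
  combLimit_ofReal_im_pos hξ (by rw [abs_neg, lt_abs]; left; nlinarith)

lemma combLimit_criticalValue (hξ : 2 < ξ) :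
    combLimit ξ ((-(ξ ^ 2 - ξ) : ℝ) : ℂ) = -1 + combHeight ξ * I := by
  apply Complex.ext
  · rw [(isStripMap_combLimit hξ).re_left _ (by nlinarith)]; simp
  · simp [combHeight]

/-- On the imaginary axis, `P` takes values to the left of the critical value. -/
lemma combLimit_im_gt_of_re_eq_zero (hξ : 2 < ξ) {z : ℂ} (hz : z ∈ openUpper) (h : z.re = 0) :
    (combLimit ξ z).re = -1 / 2 ∧ combHeight ξ / 2 < (combLimit ξ z).im := by
  have hz' : 0 < z.im := hz
  have h1 := two_mul_combLimit_of_re_nonneg hξ (openUpper_subset_closedUpper hz) h.ge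
  have h2 : quadFix ξ z = ((-z.im ^ 2 - (ξ ^ 2 - ξ) : ℝ) : ℂ) := by
    apply Complex.ext
    · rw [quadFix_re, h, ofReal_re]; ring
    · rw [quadFix_im, h, ofReal_im]; ring
  have hlam : -(ξ ^ 2 - ξ) ≤ -ξ := by nlinarith
  have hsq : 0 < z.im ^ 2 := by positivity
  rw [h2] at h1
  constructor
  · have := congrArg re h1
    rw [(isStripMap_combLimit hξ).re_left _ (by linarith), two_mul_re] at this
    linarith
  · have h3 := combLimit_im_strictAntiOn hξ (a := -z.im ^ 2 - (ξ ^ 2 - ξ)) (b := -(ξ ^ 2 - ξ))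
      (show _ ≤ -ξ by linarith) hlam (by linarith)
    have := congrArg im h1
    rw [two_mul_im] at this
    change combHeight ξ < _ at h3
    simp only at h3
    linarith

lemma quadFix_mem_openUpper {z : ℂ} (hz : z ∈ openUpper) (h : 0 < z.re) :
    quadFix ξ z ∈ openUpper := by
  have hz' : 0 < z.im := hz
  change 0 < (quadFix ξ z).im
  rw [quadFix_im]; positivity

lemma conj_quadFix_mem_openUpper {z : ℂ} (hz : z ∈ openUpper) (h : z.re < 0) :
    conj (quadFix ξ z) ∈ openUpper := by
  have hz' : 0 < z.im := hz
  change 0 < (conj (quadFix ξ z)).im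
  rw [conj_im, quadFix_im]; nlinarith

/-- The image of the upper half-plane avoids the slits. Under doubling and folding, a slit of level
`m` goes to one of level `m - 1`, and the slit of level `1` comes from the imaginary axis. -/
lemma lt_combLimit_im (hξ : 2 < ξ) (m : ℕ) {k : ℕ} {z : ℂ} (hz : z ∈ openUpper)
    (hre : (combLimit ξ z).re = -(k : ℝ) / 2 ^ m) : combHeight ξ / 2 ^ m < (combLimit ξ z).im := by
  induction m generalizing k z with
  | zero =>
    -- an integral real part contradicts `-1 < Re < 0`
    have h := (combLimit_mem_strip hξ hz).1
    rw [hre, pow_zero, div_one] at h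
    have h1 : (0 : ℝ) < k := by linarith [h.2]
    have h2 : (k : ℝ) < 1 := by linarith [h.1]
    norm_cast at h1 h2
    omega
  | succ m ih =>
    have h2m : (0 : ℝ) < 2 ^ m := by positivity
    have hdiv : combHeight ξ / 2 ^ (m + 1) = combHeight ξ / 2 ^ m / 2 := by
      rw [pow_succ, div_div]
    have hre' : 2 * (combLimit ξ z).re = -(k : ℝ) / 2 ^ m := by
      rw [hre, pow_succ]; field_simp
    have hzc := openUpper_subset_closedUpper hz
    rcases lt_trichotomy z.re 0 with h | h | h
    · have h1 := two_mul_combLimit_of_re_nonpos hξ hzc h.le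
      have h2 := conj_quadFix_mem_openUpper (ξ := ξ) hz h
      have h3 := congrArg re h1
      have h4 := congrArg im h1
      rw [two_mul_re, hre', reflectLine_re] at h3
      rw [two_mul_im, reflectLine_im] at h4
      have hk : k ≤ 2 ^ (m + 1) := by
        have := (combLimit_mem_strip hξ hz).1.1
        rw [hre, lt_div_iff₀ (by positivity)] at this
        have h5 : (k : ℝ) < 2 ^ (m + 1) := by linarith
        exact_mod_cast h5.le
      have h5 := ih (k := 2 ^ (m + 1) - k) h2 (by
        rw [Nat.cast_sub hk]
        push_cast
        rw [pow_succ]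
        field_simp
        field_simp at h3
        linarith)
      rw [hdiv]; linarith
    · have h1 := (combLimit_im_gt_of_re_eq_zero hξ hz h).2
      have h2 : combHeight ξ / 2 ^ (m + 1) ≤ combHeight ξ / 2 := by
        rw [hdiv]
        have : combHeight ξ / 2 ^ m ≤ combHeight ξ :=
          div_le_self (combHeight_pos hξ).le (one_le_pow₀ one_le_two)
        linarith
      linarith
    · have h1 := two_mul_combLimit_of_re_nonneg hξ hzc h.le
      have h2 := quadFix_mem_openUpper (ξ := ξ) hz h
      have h3 := congrArg re h1
      have h4 := congrArg im h1
      rw [two_mul_re, hre'] at h3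
      rw [two_mul_im] at h4
      have h5 := ih h2 h3.symm
      rw [hdiv]; linarith

lemma combLimit_mem_combDomain (hξ : 2 < ξ) {z : ℂ} (hz : z ∈ openUpper) :
    combLimit ξ z ∈ combDomain (combHeight ξ) := by
  rw [mem_combDomain_iff (combHeight_pos hξ)]
  obtain ⟨h1, h2⟩ := combLimit_mem_strip hξ hz
  exact ⟨h1, h2, fun m k _ _ _ hre => lt_combLimit_im hξ m hz hre⟩

lemma two_mul_mem_combDomain {a : ℝ} (ha : 0 < a) {w : ℂ} (hw : w ∈ combDomain a)
    (h : -1 / 2 < w.re) : 2 * w ∈ combDomain a := by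
  rw [mem_combDomain_iff ha] at hw ⊢
  obtain ⟨h1, h2, h3⟩ := hw
  rw [two_mul_re, two_mul_im]
  refine ⟨⟨by linarith, by linarith [h1.2]⟩, by linarith, fun m k hm hk hkm hre => ?_⟩
  have h4 := h3 (m + 1) k (by omega) hk (hkm.trans (Nat.pow_le_pow_right two_pos (by omega))) (by
    rw [pow_succ, ← div_div, ← hre]; ring)
  rw [pow_succ, ← div_div] at h4
  linarith

lemma reflectLine_two_mul_mem_combDomain {a : ℝ} (ha : 0 < a) {w : ℂ} (hw : w ∈ combDomain a)
    (h : w.re < -1 / 2) : reflectLine (2 * w) ∈ combDomain a := by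
  rw [mem_combDomain_iff ha] at hw ⊢
  obtain ⟨h1, h2, h3⟩ := hw
  rw [reflectLine_re, reflectLine_im, two_mul_re, two_mul_im]
  refine ⟨⟨by linarith [h1.1], by linarith [h1.1]⟩, by linarith, fun m k hm hk hkm hre => ?_⟩
  have hk' : k ≤ 2 ^ (m + 1) := hkm.trans (Nat.pow_le_pow_right two_pos (by omega))
  have hodd : Odd (2 ^ (m + 1) - k) :=
    Nat.Even.sub_odd hk' ((Nat.even_pow.2 ⟨even_two, by omega⟩)) hk
  have h4 := h3 (m + 1) (2 ^ (m + 1) - k) (by omega) hodd (Nat.sub_le _ _) (by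
    rw [Nat.cast_sub hk']
    push_cast
    rw [pow_succ]
    field_simp
    field_simp at hre
    linarith)
  rw [pow_succ, ← div_div] at h4
  linarith

/-- The real axis is mapped to the boundary of the comb: bounded orbits go to the base, the points
outside of `[-ξ, ξ]` to the two sides, and the other points, by the functional equation, to the
slits. -/
lemma combLimit_ofReal_notMem (hξ : 2 < ξ) (x : ℝ) :
    combLimit ξ x ∉ combDomain (combHeight ξ) := by
  have ha := combHeight_pos hξ
  have hout : ∀ y : ℝ, ξ ≤ |y| → combLimit ξ y ∉ combDomain (combHeight ξ) := by
    intro y hy hmem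
    rw [mem_combDomain_iff ha] at hmem
    rcases le_abs.1 hy with h | h
    · exact hmem.1.2.ne ((isStripMap_combLimit hξ).re_right y h)
    · exact hmem.1.1.ne' ((isStripMap_combLimit hξ).re_left y (by linarith))
  by_cases hesc : ∃ n, ξ < ‖(quadFix ξ)^[n] x‖
  · obtain ⟨n, hn⟩ := hesc
    induction n generalizing x with
    | zero => exact hout x (by simpa using hn.le)
    | succ n ih =>
      by_cases hx : ξ ≤ |x|
      · exact hout x hx
      push Not at hx
      rw [Function.iterate_succ_apply, quadFix_ofReal] at hn
      have hP := ih _ hn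
      intro hmem
      -- points on the middle line lie above the slit of level `1`, but `P x` is not to the left of
      -- the critical value
      have hmid : (combLimit ξ x).re ≠ -1 / 2 := by
        intro hre
        have h1 := ((mem_combDomain_iff ha _).1 hmem).2.2 1 1 le_rfl odd_one (by norm_num)
          (by rw [hre]; norm_num)
        have h2 : (combLimit ξ ((x ^ 2 - (ξ ^ 2 - ξ) : ℝ) : ℂ)).re = -1 := by
          rcases le_total 0 x with h | h
          · have := congrArg re (two_mul_combLimit_ofReal_of_nonneg hξ h)
            rw [two_mul_re, hre] at this
            linarith
          · have := congrArg re (two_mul_combLimit_ofReal_of_nonpos hξ h)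
            rw [two_mul_re, hre, reflectLine_re] at this
            linarith
        rw [combLimit_ofReal_re_eq_neg_one_iff hξ] at h2
        have h3 := (combLimit_im_strictAntiOn hξ).antitoneOn (a := -(ξ ^ 2 - ξ))
          (show _ ≤ -ξ by nlinarith) h2 (by nlinarith [sq_nonneg x])
        have h4 := two_mul_combLimit_ofReal_im hξ x
        change _ ≤ combHeight ξ at h3
        rw [pow_one] at h1
        linarith
      rcases le_total 0 x with h | h
      · have h1 := two_mul_combLimit_ofReal_of_nonneg hξ h
        have h2 := ((isStripMap_combLimit hξ).re_mem _
          (ofReal_mem_closedUpper (x ^ 2 - (ξ ^ 2 - ξ)))).1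
        rw [← h1] at hP h2
        rw [two_mul_re] at h2
        exact hP (two_mul_mem_combDomain ha hmem (lt_of_le_of_ne (by linarith) (Ne.symm hmid)))
      · have h1 := two_mul_combLimit_ofReal_of_nonpos hξ h
        have h2 := ((isStripMap_combLimit hξ).re_mem _
          (ofReal_mem_closedUpper (x ^ 2 - (ξ ^ 2 - ξ)))).1
        have h3 := congrArg re h1
        rw [two_mul_re, reflectLine_re] at h3
        have h4 := reflectLine_two_mul_mem_combDomain ha hmem
          (lt_of_le_of_ne (by linarith) hmid)
        rw [h1, reflectLine_reflectLine] at h4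
        exact hP h4
  · push Not at hesc
    intro hmem
    rw [mem_combDomain_iff ha] at hmem
    exact hmem.2.1.ne' ((combLimit_im_eq_zero_iff hξ (ofReal_mem_closedUpper x)).2 hesc)

/-- The comb domain is connected: every point can be joined to the part above the slits by a
vertical segment. -/
lemma isPreconnected_combDomain {a : ℝ} (ha : 0 < a) : IsPreconnected (combDomain a) := by
  have htop : ∀ w : ℂ, w.re ∈ Ioo (-1 : ℝ) 0 → a < w.im → w ∈ combDomain a := by
    intro w h1 h2
    rw [mem_combDomain_iff ha]
    refine ⟨h1, ha.trans h2, fun m k _ _ _ _ => lt_of_le_of_lt ?_ h2⟩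
    exact div_le_self ha.le (one_le_pow₀ one_le_two)
  have hup : ∀ w ∈ combDomain a, ∀ v : ℂ, v.re = w.re → w.im ≤ v.im → v ∈ combDomain a := by
    intro w hw v h1 h2
    rw [mem_combDomain_iff ha] at hw ⊢
    rw [h1]
    exact ⟨hw.1, hw.2.1.trans_le h2, fun m k hm hk hkm hre =>
      (hw.2.2 m k hm hk hkm hre).trans_le h2⟩
  refine isPreconnected_of_forall (-1 / 2 + (a + 1) * I : ℂ) fun w hw => ?_
  have hw' := (mem_combDomain_iff ha w).1 hw
  set T : Set ℂ := {v | v.re ∈ Ioo (-1 : ℝ) 0} ∩ {v | a < v.im}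
  set L : Set ℂ := {v | v.re = w.re} ∩ {v | w.im ≤ v.im}
  have hT : Convex ℝ T := ((convex_Ioo (-1 : ℝ) 0).linear_preimage reLm).inter
    (convex_halfSpace_im_gt a)
  have hL : Convex ℝ L := ((convex_singleton w.re).linear_preimage reLm).inter
    (convex_halfSpace_im_ge w.im)
  refine ⟨T ∪ L, ?_, Or.inl ⟨?_, ?_⟩, Or.inr ⟨rfl, le_refl w.im⟩, ?_⟩
  · rintro v (hv | hv)
    · exact htop v hv.1 hv.2
    · exact hup w hw v hv.1 hv.2
  · simp; norm_num
  · simp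
  · refine IsPreconnected.union' ⟨⟨w.re, max w.im (a + 1)⟩, ⟨hw'.1, ?_⟩, ⟨rfl, ?_⟩⟩
      hT.isPreconnected hL.isPreconnected
    · exact lt_of_lt_of_le (lt_add_one a) (le_max_right w.im _)
    · exact le_max_left w.im (a + 1)

/-- The image is relatively closed in the comb domain, because the boundary goes to the boundary and
`∞` to `∞`. Being open as well, it is the whole comb domain. -/
lemma image_combLimit (hξ : 2 < ξ) : combLimit ξ '' openUpper = combDomain (combHeight ξ) := by
  apply Subset.antisymm
  · rintro _ ⟨z, hz, rfl⟩
    exact combLimit_mem_combDomain hξ hz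
  refine (isPreconnected_combDomain (combHeight_pos hξ)).subset_of_closure_inter_subset
    (isOpen_image_combLimit hξ) ?_ ?_
  · have hI : I ∈ openUpper := by simp [openUpper]
    exact ⟨_, combLimit_mem_combDomain hξ hI, mem_image_of_mem _ hI⟩
  rintro w ⟨hw1, hw2⟩
  rw [mem_closure_iff_seq_limit] at hw1
  obtain ⟨u, hu, hlim⟩ := hw1
  choose z hz hzu using hu
  have hzc : ∀ n, z n ∈ closedUpper := fun n => openUpper_subset_closedUpper (hz n)
  obtain ⟨K, hK, hKsub⟩ : ∃ K : Set ℂ, IsCompact K ∧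
      ∀ v ∈ closedUpper, ‖combLimit ξ v‖ ≤ ‖w‖ + 1 → v ∈ K := by
    have h1 : {v : ℂ | ‖v‖ ≤ ‖w‖ + 1}ᶜ ∈ cocompact ℂ := by
      refine IsCompact.compl_mem_cocompact ?_
      simpa [Metric.closedBall, dist_eq_norm] using isCompact_closedBall (0 : ℂ) (‖w‖ + 1)
    have h2 := tendsto_combLimit_cocompact hξ h1
    rw [mem_map, mem_inf_principal, mem_cocompact] at h2
    obtain ⟨K, hK, hsub⟩ := h2
    refine ⟨K, hK, fun v hv hle => ?_⟩
    by_contra hvK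
    exact hsub hvK hv hle
  have hev : ∀ᶠ n in atTop, z n ∈ K ∩ closedUpper := by
    filter_upwards [hlim.norm.eventually (eventually_le_nhds (lt_add_one ‖w‖))] with n hn
    exact ⟨hKsub _ (hzc n) (by rw [hzu]; exact hn), hzc n⟩
  obtain ⟨v, hv, φ, hφ, hconv⟩ :=
    (hK.inter_right isClosed_closedUpper).tendsto_subseq' hev.frequently
  have hval : combLimit ξ v = w := by
    have h1 : Tendsto (fun n => combLimit ξ (z (φ n))) atTop (𝓝 (combLimit ξ v)) :=
      ((isStripMap_combLimit hξ).continuousOn v hv.2).tendsto.comp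
        (tendsto_nhdsWithin_iff.2 ⟨hconv, Eventually.of_forall fun n => hzc _⟩)
    have h2 : Tendsto (fun n => combLimit ξ (z (φ n))) atTop (𝓝 w) := by
      simp only [hzu]
      exact hlim.comp hφ.tendsto_atTop
    exact tendsto_nhds_unique h1 h2
  refine ⟨v, ?_, hval⟩
  rcases (show 0 ≤ v.im from hv.2).lt_or_eq with h | h
  · exact h
  · have hvr : v = (v.re : ℂ) := Complex.ext rfl (by simpa using h.symm)
    rw [← hval, hvr] at hw2
    exact absurd hw2 (combLimit_ofReal_notMem hξ v.re)

lemma bijOn_combLimit (hξ : 2 < ξ) :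
    BijOn (combLimit ξ) openUpper (combDomain (combHeight ξ)) := by
  rw [← image_combLimit hξ]
  exact (injOn_combLimit hξ).bijOn_image

/-! ### The extension by reflection -/

lemma quadFix_mem_cutPlane {z : ℂ} (hz : z ∈ openUpper) :
    quadFix ξ z ∈ cutPlane (-(ξ ^ 2 - ξ)) := by
  have hz' : 0 < z.im := hz
  rintro ⟨h1, h2⟩
  rw [quadFix_im] at h1
  rw [quadFix_re] at h2
  have hre : z.re = 0 := by
    rcases mul_eq_zero.1 h1 with h | h
    · linarith
    · exact absurd h hz'.ne'
  rw [hre] at h2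
  nlinarith

/-- The functional equation in terms of the extension by reflection. -/
lemma reflectedExtension_combLimit_quadFix (hξ : 2 < ξ) {z : ℂ} (hz : z ∈ openUpper) :
    reflectedExtension (combLimit ξ) (quadFix ξ z) = 2 * combLimit ξ z := by
  have hz' : 0 < z.im := hz
  have hzc := openUpper_subset_closedUpper hz
  rw [reflectedExtension, quadFix_im]
  split_ifs with h
  · rw [two_mul_combLimit_of_re_nonneg hξ hzc]
    by_contra! hneg
    nlinarith
  · rw [two_mul_combLimit_of_re_nonpos hξ hzc]
    by_contra! hpos
    exact h (by positivity)

/-- The inverse of the polynomial on the cut plane, with values in the upper half-plane. -/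
noncomputable def quadFixInv (ξ : ℝ) (w : ℂ) : ℂ := I * exp (log (-(w + (ξ ^ 2 - ξ : ℝ))) / 2)

lemma neg_add_mem_slitPlane {w : ℂ} (hw : w ∈ cutPlane (-(ξ ^ 2 - ξ))) :
    -(w + (ξ ^ 2 - ξ : ℝ)) ∈ slitPlane := by
  rw [mem_slitPlane_iff, neg_re, neg_im, add_re, add_im, ofReal_re, ofReal_im]
  by_contra! h
  exact hw ⟨by linarith [h.2], by linarith [h.1]⟩

lemma quadFixInv_mem_openUpper {w : ℂ} (hw : w ∈ cutPlane (-(ξ ^ 2 - ξ))) :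
    quadFixInv ξ w ∈ openUpper := by
  change 0 < (quadFixInv ξ w).im
  have h := neg_add_mem_slitPlane hw
  rw [mem_slitPlane_iff_arg] at h
  have h1 := neg_pi_lt_arg (-(w + (ξ ^ 2 - ξ : ℝ)))
  have h2 := lt_of_le_of_ne (arg_le_pi (-(w + (ξ ^ 2 - ξ : ℝ)))) h.1
  rw [quadFixInv, I_mul_im, exp_re, div_ofNat_im, log_im]
  exact mul_pos (Real.exp_pos _) (Real.cos_pos_of_mem_Ioo ⟨by linarith, by linarith⟩)

lemma quadFix_quadFixInv {w : ℂ} (hw : w ∈ cutPlane (-(ξ ^ 2 - ξ))) :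
    quadFix ξ (quadFixInv ξ w) = w := by
  have h := slitPlane_ne_zero (neg_add_mem_slitPlane hw)
  rw [quadFix_apply, quadFixInv, mul_pow, ← exp_nat_mul, I_sq]
  rw [show ((2 : ℕ) : ℂ) * (log (-(w + (ξ ^ 2 - ξ : ℝ))) / 2) = log (-(w + (ξ ^ 2 - ξ : ℝ))) by
    push_cast; ring, exp_log h]
  push_cast
  ring

lemma isOpen_cutPlane (c : ℝ) : IsOpen (cutPlane c) :=
  ((isClosed_eq continuous_im continuous_const).inter
    (isClosed_le continuous_const continuous_re)).isOpen_compl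

/-- Holomorphy across the cut is inherited from the upper half-plane by the functional equation
`ext θ = 2 θ ∘ P⁻¹`. -/
lemma differentiableOn_reflectedExtension (hξ : 2 < ξ) :
    DifferentiableOn ℂ (reflectedExtension (combLimit ξ)) (cutPlane (-(ξ ^ 2 - ξ))) := by
  have h : DifferentiableOn ℂ (fun w => 2 * combLimit ξ (quadFixInv ξ w))
      (cutPlane (-(ξ ^ 2 - ξ))) := by
    refine ((differentiableOn_combLimit hξ).comp (t := openUpper) ?_
      fun w hw => quadFixInv_mem_openUpper hw).const_mul 2
    intro w hw
    have := neg_add_mem_slitPlane hw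
    unfold quadFixInv
    refine DifferentiableAt.differentiableWithinAt ?_
    fun_prop (disch := assumption)
  refine h.congr fun w hw => ?_
  rw [← reflectedExtension_combLimit_quadFix hξ (quadFixInv_mem_openUpper hw),
    quadFix_quadFixInv hw]

lemma reflectedExtension_of_im_neg {f : ℂ → ℂ} {z : ℂ} (hz : z.im < 0) :
    reflectedExtension f z = reflectLine (f (conj z)) := by
  rw [reflectedExtension, if_neg (not_le.2 hz)]

lemma reflectedExtension_of_mem {f : ℂ → ℂ} {z : ℂ} (hz : z ∈ closedUpper) :
    reflectedExtension f z = f z := by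
  rw [reflectedExtension]; exact if_pos hz

lemma reflectedExtension_combLimit_injOn (hξ : 2 < ξ) :
    InjOn (reflectedExtension (combLimit ξ)) (cutPlane (-(ξ ^ 2 - ξ))) := by
  intro w hw v hv h
  have h1 := quadFixInv_mem_openUpper hw
  have h2 := quadFixInv_mem_openUpper hv
  rw [← quadFix_quadFixInv hw, ← quadFix_quadFixInv hv,
    reflectedExtension_combLimit_quadFix hξ h1, reflectedExtension_combLimit_quadFix hξ h2] at h
  rw [← quadFix_quadFixInv hw, ← quadFix_quadFixInv hv,
    injOn_combLimit hξ h1 h2 (mul_left_cancel₀ two_ne_zero h)]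

lemma conformalOnto_reflectedExtension (hξ : 2 < ξ) :
    ConformalOnto (reflectedExtension (combLimit ξ)) (cutPlane (-(ξ ^ 2 - ξ)))
      (doubledComb (combHeight ξ)) := by
  have ha := combHeight_pos hξ
  refine ⟨differentiableOn_reflectedExtension hξ, ?_, reflectedExtension_combLimit_injOn hξ, ?_⟩
  · intro w hw
    rcases lt_trichotomy w.im 0 with h | h | h
    · rw [reflectedExtension_of_im_neg h]
      refine Or.inl (Or.inl (mem_image_of_mem _ (combLimit_mem_combDomain hξ ?_)))
      change 0 < (conj w).im
      simpa using h
    · have hwr : w = (w.re : ℂ) := Complex.ext rfl (by simpa using h)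
      have hlt : w.re < -(ξ ^ 2 - ξ) := by
        by_contra! hge
        exact hw ⟨h, hge⟩
      rw [hwr, reflectedExtension_of_mem (ofReal_mem_closedUpper _)]
      refine Or.inl (Or.inr ⟨(isStripMap_combLimit hξ).re_left _ (by nlinarith), ?_⟩)
      exact combLimit_im_strictAntiOn hξ (show w.re ≤ -ξ by nlinarith)
        (show -(ξ ^ 2 - ξ) ≤ -ξ by nlinarith) hlt
    · rw [reflectedExtension_of_mem (openUpper_subset_closedUpper h)]
      exact Or.inr (combLimit_mem_combDomain hξ h)
  · rintro w ((⟨v, hv, rfl⟩ | ⟨h1, h2⟩) | hw)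
    · obtain ⟨z, hz, rfl⟩ := (bijOn_combLimit hξ).surjOn hv
      have hz' : 0 < z.im := hz
      refine ⟨conj z, fun h => ?_, ?_⟩
      · have := h.1
        simp at this
        exact hz'.ne' this
      · rw [reflectedExtension_of_im_neg (by simpa using hz'), conj_conj]
    · have hw : w / 2 ∈ combDomain (combHeight ξ) := by
        rw [mem_combDomain_iff ha, div_ofNat_re, div_ofNat_im, h1]
        refine ⟨by norm_num, by linarith, fun m k hm _ _ _ => ?_⟩
        have : combHeight ξ / 2 ^ m ≤ combHeight ξ / 2 ^ 1 := by gcongr; norm_num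
        linarith
      obtain ⟨z, hz, hzw⟩ := (bijOn_combLimit hξ).surjOn hw
      refine ⟨_, quadFix_mem_cutPlane hz, ?_⟩
      rw [reflectedExtension_combLimit_quadFix hξ hz, hzw]
      ring
    · obtain ⟨z, hz, rfl⟩ := (bijOn_combLimit hξ).surjOn hw
      have hz' : 0 < z.im := hz
      exact ⟨z, fun h => hz'.ne' h.1, reflectedExtension_of_mem (openUpper_subset_closedUpper hz)⟩

/-! ### Conformal automorphisms of the half-plane fixing infinity -/

/-- The inverse of an injective holomorphic function is holomorphic. At the isolated zeros of the
derivative this follows from Riemann's theorem on removable singularities, so the derivative need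
not be shown to be nonzero first. -/
lemma differentiableAt_of_leftInvOn {f g : ℂ → ℂ} {U : Set ℂ} (hU : IsOpen U)
    (hf : DifferentiableOn ℂ f U) (hg : LeftInvOn g f U) {z : ℂ} (hz : z ∈ U) :
    DifferentiableAt ℂ g (f z) := by
  have hinj : InjOn f U := hg.injOn
  have hnc : ∀ w ∈ U, ¬ ∀ᶠ v in 𝓝 w, f v = f w := by
    intro w hw hc
    have h1 : ∀ᶠ v in 𝓝[≠] w, f v = f w ∧ v ∈ U :=
      (hc.and (hU.mem_nhds hw)).filter_mono nhdsWithin_le_nhds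
    obtain ⟨v, ⟨hv1, hv2⟩, hv3⟩ := (h1.and self_mem_nhdsWithin).exists
    exact hv3 (hinj hv2 hw hv1)
  have hopen : ∀ w ∈ U, 𝓝 (f w) ≤ map f (𝓝 w) := fun w hw =>
    ((hf.analyticAt (hU.mem_nhds hw)).eventually_constant_or_nhds_le_map_nhds).resolve_left
      (hnc w hw)
  have hcont : ∀ w ∈ U, ContinuousAt g (f w) := by
    intro w hw
    rw [ContinuousAt, hg hw]
    refine (map_mono (hopen w hw)).trans ?_
    rw [map_map]
    refine (tendsto_id (x := 𝓝 w)).congr' ?_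
    filter_upwards [hU.mem_nhds hw] with v hv using (hg hv).symm
  have himage : ∀ w ∈ U, ∀ᶠ y in 𝓝 (f w), g y ∈ U ∧ f (g y) = y := by
    intro w hw
    refine hopen w hw ?_
    rw [mem_map]
    filter_upwards [hU.mem_nhds hw] with v hv
    have : g (f v) = v := hg hv
    simp [this, hv]
  have hreg : ∀ w ∈ U, deriv f w ≠ 0 → DifferentiableAt ℂ g (f w) := by
    intro w hw hd
    have hfd : HasDerivAt f (deriv f w) (g (f w)) := by
      rw [hg hw]; exact (hf.differentiableAt (hU.mem_nhds hw)).hasDerivAt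
    exact (HasDerivAt.of_local_left_inverse (hcont w hw) hfd hd
      ((himage w hw).mono fun y hy => hy.2)).differentiableAt
  have hda : AnalyticAt ℂ (deriv f) z := (hf.analyticAt (hU.mem_nhds hz)).deriv
  rcases hda.eventually_eq_zero_or_eventually_ne_zero with h0 | h0
  · exfalso
    obtain ⟨ε, hε, hball⟩ := Metric.eventually_nhds_iff_ball.1 (h0.and (hU.mem_nhds hz))
    refine hnc z hz ?_
    filter_upwards [Metric.ball_mem_nhds z hε] with v hv
    exact (convex_ball z ε).is_const_of_fderivWithin_eq_zero (𝕜 := ℂ)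
      (hf.mono fun y hy => (hball y hy).2)
      (fun y hy => by
        rw [fderivWithin_of_isOpen Metric.isOpen_ball hy]
        ext
        simpa using (hball y hy).1) hv (Metric.mem_ball_self hε)
  · refine (analyticAt_of_differentiable_on_punctured_nhds_of_continuousAt ?_
      (hcont z hz)).differentiableAt
    have htend : Tendsto g (𝓝[≠] (f z)) (𝓝[≠] z) := by
      rw [tendsto_nhdsWithin_iff]
      constructor
      · have := hcont z hz
        rw [ContinuousAt, hg hz] at this
        exact this.mono_left nhdsWithin_le_nhds
      · filter_upwards [(himage z hz).filter_mono nhdsWithin_le_nhds, self_mem_nhdsWithin]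
          with y hy hne h
        rw [mem_singleton_iff] at h
        exact hne (by rw [← hy.2, h]; rfl)
    filter_upwards [(himage z hz).filter_mono nhdsWithin_le_nhds, htend.eventually h0] with y hy hd
    have := hreg (g y) hy.1 hd
    rwa [hy.2] at this

/-- The Cayley transform from the upper half-plane to the unit disk. -/
noncomputable def cayley (z : ℂ) : ℂ := (z - I) / (z + I)

/-- The inverse of the Cayley transform. -/
noncomputable def cayleyInv (w : ℂ) : ℂ := I * (1 + w) / (1 - w)

lemma add_I_ne_zero {z : ℂ} (hz : z ∈ openUpper) : z + I ≠ 0 := by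
  intro h
  have h1 := congrArg im h
  have h2 : 0 < z.im := hz
  simp at h1
  linarith

lemma cayley_mem_ball {z : ℂ} (hz : z ∈ openUpper) : cayley z ∈ Metric.ball (0 : ℂ) 1 := by
  have h2 : 0 < z.im := hz
  rw [mem_ball_zero_iff, cayley, norm_div, div_lt_one (norm_pos_iff.2 (add_I_ne_zero hz))]
  apply lt_of_pow_lt_pow_left₀ 2 (norm_nonneg _)
  rw [Complex.sq_norm, Complex.sq_norm, normSq_apply, normSq_apply]
  simp
  nlinarith

lemma one_sub_ne_zero_of_mem_ball {w : ℂ} (hw : w ∈ Metric.ball (0 : ℂ) 1) : 1 - w ≠ 0 := by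
  intro h
  rw [← sub_eq_zero.1 h] at hw
  simp at hw

lemma cayleyInv_mem_openUpper {w : ℂ} (hw : w ∈ Metric.ball (0 : ℂ) 1) :
    cayleyInv w ∈ openUpper := by
  have hne := one_sub_ne_zero_of_mem_ball hw
  have hw2 : ‖w‖ ^ 2 < 1 := by
    have := mem_ball_zero_iff.1 hw
    nlinarith [norm_nonneg w]
  rw [Complex.sq_norm, normSq_apply] at hw2
  change 0 < (cayleyInv w).im
  have : (cayleyInv w).im = (1 - (w.re * w.re + w.im * w.im)) / normSq (1 - w) := by
    rw [cayleyInv, div_im]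
    simp
    ring
  rw [this]
  exact div_pos (by linarith) (normSq_pos.2 hne)

lemma cayley_cayleyInv {w : ℂ} (hw : w ∈ Metric.ball (0 : ℂ) 1) : cayley (cayleyInv w) = w := by
  have h1 := one_sub_ne_zero_of_mem_ball hw
  have h2 := add_I_ne_zero (cayleyInv_mem_openUpper hw)
  rw [cayley, div_eq_iff h2, cayleyInv]
  field_simp
  ring

lemma cayleyInv_cayley {z : ℂ} (hz : z ∈ openUpper) : cayleyInv (cayley z) = z := by
  have h1 := add_I_ne_zero hz
  have h2 := one_sub_ne_zero_of_mem_ball (cayley_mem_ball hz)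
  rw [cayleyInv, div_eq_iff h2, cayley]
  field_simp
  ring

lemma cayley_I : cayley I = 0 := by simp [cayley]

lemma cayleyInv_zero : cayleyInv 0 = I := by simp [cayleyInv]

lemma differentiableAt_cayley {z : ℂ} (hz : z ∈ openUpper) : DifferentiableAt ℂ cayley z := by
  have := add_I_ne_zero hz
  unfold cayley
  fun_prop (disch := assumption)

lemma differentiableAt_cayleyInv {w : ℂ} (hw : w ∈ Metric.ball (0 : ℂ) 1) :
    DifferentiableAt ℂ cayleyInv w := by
  have := one_sub_ne_zero_of_mem_ball hw
  unfold cayleyInv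
  fun_prop (disch := assumption)

lemma tendsto_cayley_cocompact : Tendsto cayley (cocompact ℂ) (𝓝 1) := by
  have h1 : Tendsto (fun z : ℂ => z + I) (cocompact ℂ) (cocompact ℂ) :=
    (Homeomorph.addRight I).isClosedEmbedding.tendsto_cocompact
  have h2 : Tendsto (fun z : ℂ => 1 - 2 * I * (z + I)⁻¹) (cocompact ℂ) (𝓝 (1 - 2 * I * 0)) := by
    rw [← Metric.cobounded_eq_cocompact] at h1 ⊢
    exact ((tendsto_inv₀_cobounded.comp h1).const_mul _).const_sub _
  rw [mul_zero, sub_zero] at h2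
  refine h2.congr' ?_
  have : {(-I : ℂ)}ᶜ ∈ cocompact ℂ := isCompact_singleton.compl_mem_cocompact
  filter_upwards [this] with z hz
  have : z + I ≠ 0 := fun h => hz (by rw [mem_singleton_iff]; linear_combination h)
  rw [cayley]
  field_simp
  ring

/-- The Schwarz lemma on the upper half-plane for maps with the fixed point `i`, together with the
properties of the transported map of the disk. -/
lemma norm_cayley_le {ψ : ℂ → ℂ} (hd : DifferentiableOn ℂ ψ openUpper)
    (hm : MapsTo ψ openUpper openUpper) (hI : ψ I = I) :
    DifferentiableOn ℂ (fun w => cayley (ψ (cayleyInv w))) (Metric.ball 0 1) ∧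
      MapsTo (fun w => cayley (ψ (cayleyInv w))) (Metric.ball 0 1) (Metric.ball 0 1) ∧
      ∀ z ∈ openUpper, ‖cayley (ψ z)‖ ≤ ‖cayley z‖ := by
  have h1 : DifferentiableOn ℂ (fun w => cayley (ψ (cayleyInv w))) (Metric.ball 0 1) := by
    intro w hw
    have hz := cayleyInv_mem_openUpper hw
    exact ((differentiableAt_cayley (hm hz)).comp w
      ((hd.differentiableAt (isOpen_openUpper.mem_nhds hz)).comp w
        (differentiableAt_cayleyInv hw))).differentiableWithinAt
  have h2 : MapsTo (fun w => cayley (ψ (cayleyInv w))) (Metric.ball 0 1) (Metric.ball 0 1) :=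
    fun w hw => cayley_mem_ball (hm (cayleyInv_mem_openUpper hw))
  refine ⟨h1, h2, fun z hz => ?_⟩
  have h3 := norm_le_norm_of_mapsTo_ball h1 (h2.mono_right Metric.ball_subset_closedBall)
    (by simp [cayleyInv_zero, hI, cayley_I]) (mem_ball_zero_iff.1 (cayley_mem_ball hz))
  simpa only [cayleyInv_cayley hz] using h3

/-- An automorphism of the upper half-plane that fixes `i` and `∞` is the identity. -/
lemma eq_self_of_automorphism {ψ : ℂ → ℂ} (hd : DifferentiableOn ℂ ψ openUpper)
    (hb : BijOn ψ openUpper openUpper) (hI : ψ I = I)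
    (hinf : Tendsto ψ (cocompact ℂ ⊓ 𝓟 openUpper) (cocompact ℂ)) {z : ℂ} (hz : z ∈ openUpper) :
    ψ z = z := by
  have hIm : I ∈ openUpper := by simp [openUpper]
  obtain ⟨h1, h2, h3⟩ := norm_cayley_le hd hb.mapsTo hI
  set g := Function.invFunOn ψ openUpper
  have hg := hb.invOn_invFunOn
  have hgd : DifferentiableOn ℂ g openUpper := by
    intro w hw
    obtain ⟨v, hv, rfl⟩ := hb.surjOn hw
    exact (differentiableAt_of_leftInvOn isOpen_openUpper hd hg.1 hv).differentiableWithinAt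
  have hgm : MapsTo g openUpper openUpper := hb.surjOn.mapsTo_invFunOn
  have hgI : g I = I := by
    have := hg.1 hIm
    rwa [hI] at this
  obtain ⟨-, -, h4⟩ := norm_cayley_le hgd hgm hgI
  have hnorm : ∀ v ∈ openUpper, ‖cayley (ψ v)‖ = ‖cayley v‖ := fun v hv => by
    refine le_antisymm (h3 v hv) ?_
    have := h4 (ψ v) (hb.mapsTo hv)
    have hgv : g (ψ v) = v := hg.1 hv
    rwa [hgv] at this
  have h0 : cayley (ψ (cayleyInv 0)) = 0 := by rw [cayleyInv_zero, hI, cayley_I]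
  have hhalf : (1 / 2 : ℂ) ∈ Metric.ball (0 : ℂ) 1 := by simp; norm_num
  have haff := affine_of_mapsTo_ball_of_norm_dslope_eq_div h1
    (by rw [h0]; exact h2.mono_right Metric.ball_subset_closedBall) hhalf (by
      rw [dslope_of_ne _ (by norm_num), slope_def_module, h0, sub_zero, sub_zero, norm_smul,
        hnorm _ (cayleyInv_mem_openUpper hhalf), cayley_cayleyInv hhalf]
      norm_num)
  set C := dslope (fun w => cayley (ψ (cayleyInv w))) 0 (1 / 2)
  have hlin : ∀ v ∈ openUpper, cayley (ψ v) = cayley v * C := by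
    intro v hv
    have := haff (cayley_mem_ball hv)
    simpa only [cayleyInv_cayley hv, h0, zero_add, sub_zero, smul_eq_mul] using this
  -- both sides tend to their values at `∞`
  have hC : C = 1 := by
    have hne : (cocompact ℂ ⊓ 𝓟 openUpper).NeBot := by
      have ht : Tendsto (fun n : ℕ => ((n : ℂ) + 1) * I) atTop (cocompact ℂ ⊓ 𝓟 openUpper) := by
        refine tendsto_inf.2 ⟨?_, tendsto_principal.2 (Eventually.of_forall fun n => ?_)⟩
        · refine tendsto_cocompact_of_tendsto_dist_comp_atTop (0 : ℂ) ?_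
          refine tendsto_atTop_mono (fun n => ?_) tendsto_natCast_atTop_atTop (α := ℕ)
          rw [dist_zero_right, norm_mul, norm_I, mul_one]
          have : ((n : ℂ) + 1) = ((n + 1 : ℝ) : ℂ) := by push_cast; rfl
          rw [this, norm_real, Real.norm_of_nonneg (by positivity)]
          linarith
        · change 0 < (((n : ℂ) + 1) * I).im
          simp
          positivity
      exact ht.neBot
    have ht1 : Tendsto (fun v => cayley (ψ v)) (cocompact ℂ ⊓ 𝓟 openUpper) (𝓝 1) :=
      tendsto_cayley_cocompact.comp hinf
    have ht2 : Tendsto (fun v => cayley v * C) (cocompact ℂ ⊓ 𝓟 openUpper) (𝓝 (1 * C)) :=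
      (tendsto_cayley_cocompact.mono_left inf_le_left).mul_const C
    rw [one_mul] at ht2
    refine tendsto_nhds_unique (ht2.congr' ?_) ht1
    filter_upwards [mem_inf_of_right (mem_principal_self _)] with v hv
    exact (hlin v hv).symm
  have := hlin z hz
  rw [hC, mul_one] at this
  rw [← cayleyInv_cayley (hb.mapsTo hz), this, cayleyInv_cayley hz]

/-- An automorphism of the upper half-plane that fixes `∞` is affine. -/
lemma exists_affine_of_automorphism {φ : ℂ → ℂ} (hd : DifferentiableOn ℂ φ openUpper)
    (hb : BijOn φ openUpper openUpper)
    (hinf : Tendsto φ (cocompact ℂ ⊓ 𝓟 openUpper) (cocompact ℂ)) :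
    ∃ q p : ℝ, 0 < q ∧ ∀ z ∈ openUpper, φ z = q * z + p := by
  have hIm : I ∈ openUpper := by simp [openUpper]
  have hq : 0 < (φ I).im := hb.mapsTo hIm
  set q := (φ I).im
  set p := (φ I).re
  have hq0 : (q : ℂ) ≠ 0 := ofReal_ne_zero.2 hq.ne'
  have haff : BijOn (fun z : ℂ => (z - p) / q) openUpper openUpper := by
    have him : ∀ z : ℂ, ((z - p) / q).im = z.im / q := fun z => by
      rw [div_ofReal_im, sub_im, ofReal_im, sub_zero]
    refine ⟨fun z hz => ?_, fun z _ w _ h => ?_, fun z hz => ⟨q * z + p, ?_, ?_⟩⟩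
    · change 0 < ((z - p) / q).im
      rw [him]
      exact div_pos hz hq
    · have := (div_left_inj' hq0).1 h
      linear_combination this
    · change 0 < (q * z + p : ℂ).im
      rw [add_im, im_ofReal_mul, ofReal_im, add_zero]
      exact mul_pos hq hz
    · simp only; field_simp; ring
  refine ⟨q, p, hq, fun z hz => ?_⟩
  have key := eq_self_of_automorphism (ψ := fun z => (φ z - p) / q)
    ((hd.sub_const _).div_const _) (haff.comp hb) ?_ ?_ hz
  · rw [div_eq_iff hq0] at key
    linear_combination key
  · have : φ I = p + q * I := (re_add_im _).symm
    rw [this]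
    field_simp
    ring
  · have h2 : Tendsto (fun z : ℂ => (z - p) / q) (cocompact ℂ) (cocompact ℂ) := by
      have := ((Homeomorph.subRight (p : ℂ)).trans
        (Homeomorph.mulRight₀ (q : ℂ)⁻¹ (inv_ne_zero hq0))).isClosedEmbedding.tendsto_cocompact
      simp only [div_eq_mul_inv]
      exact this
    exact h2.comp hinf

/-! ### Uniqueness of the comb map -/

lemma combLimit_eq_zero_iff (hξ : 2 < ξ) {x : ℝ} : combLimit ξ x = 0 ↔ x = ξ := by
  refine ⟨fun h => ?_, fun h => h ▸ combLimit_fixedPoint (h ▸ hξ)⟩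
  have h1 := (combLimit_ofReal_re_eq_zero_iff hξ).1 (by rw [h]; rfl)
  by_contra hne
  have := combLimit_ofReal_im_pos hξ
    (lt_of_lt_of_le (lt_of_le_of_ne h1 (Ne.symm hne)) (le_abs_self x))
  rw [h] at this
  simp at this

lemma combLimit_eq_neg_one_iff (hξ : 2 < ξ) {x : ℝ} : combLimit ξ x = -1 ↔ x = -ξ := by
  have h := combLimit_eq_zero_iff hξ (x := -x)
  rw [ofReal_neg, combLimit_neg_ofReal hξ] at h
  constructor
  · intro hx
    have := h.1 (by rw [hx]; simp)
    linarith
  · rintro rfl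
    rw [ofReal_neg, combLimit_neg_fixedPoint hξ]

lemma combLimit_eq_criticalValue_iff (hξ : 2 < ξ) {x : ℝ} :
    combLimit ξ x = -1 + combHeight ξ * I ↔ x = -(ξ ^ 2 - ξ) := by
  refine ⟨fun h => ?_, fun h => h ▸ combLimit_criticalValue hξ⟩
  have h1 := (combLimit_ofReal_re_eq_neg_one_iff hξ).1 (by rw [h]; simp)
  have h2 : (combLimit ξ x).im = combHeight ξ := by rw [h]; simp
  exact (combLimit_im_strictAntiOn hξ).injOn h1 (show -(ξ ^ 2 - ξ) ≤ -ξ by nlinarith) h2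

lemma ofReal_mul_mem_openUpper {z : ℂ} {c : ℝ} (hc : 0 < c) (hz : z ∈ openUpper) :
    (c : ℂ) * z ∈ openUpper := by
  change 0 < ((c : ℂ) * z).im
  rw [im_ofReal_mul]
  exact mul_pos hc hz

lemma ofReal_mul_mem_closedUpper {z : ℂ} {c : ℝ} (hc : 0 < c) (hz : z ∈ closedUpper) :
    (c : ℂ) * z ∈ closedUpper := by
  change 0 ≤ ((c : ℂ) * z).im
  rw [im_ofReal_mul]
  exact mul_nonneg hc.le hz

lemma isCombMap_combLimit (hξ : 2 < ξ) :
    IsCombMap (combHeight ξ) (fun z => combLimit ξ (ξ * z)) := by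
  have hξ0 : 0 < ξ := by linarith
  have hξc : (ξ : ℂ) ≠ 0 := ofReal_ne_zero.2 hξ0.ne'
  have hbij : BijOn (fun z : ℂ => (ξ : ℂ) * z) openUpper openUpper := by
    refine ⟨fun z hz => ofReal_mul_mem_openUpper hξ0 hz,
      fun z _ w _ h => mul_left_cancel₀ hξc h, fun z hz => ⟨((ξ⁻¹ : ℝ) : ℂ) * z,
        ofReal_mul_mem_openUpper (inv_pos.2 hξ0) hz, ?_⟩⟩
    simp only
    rw [ofReal_inv, mul_inv_cancel_left₀ hξc]
  refine ⟨⟨?_, (bijOn_combLimit hξ).comp hbij⟩, ?_, ?_, ?_, ?_⟩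
  · exact (differentiableOn_combLimit hξ).comp (by fun_prop) hbij.mapsTo
  · exact (isStripMap_combLimit hξ).continuousOn.comp (by fun_prop)
      fun z hz => ofReal_mul_mem_closedUpper hξ0 hz
  · simpa using combLimit_neg_fixedPoint hξ
  · simpa using combLimit_fixedPoint hξ
  · refine (tendsto_combLimit_cocompact hξ).comp (tendsto_inf.2 ⟨?_, ?_⟩)
    · exact (Homeomorph.mulLeft₀ (ξ : ℂ) hξc).isClosedEmbedding.tendsto_cocompact.mono_left
        inf_le_left
    · refine tendsto_principal.2 ?_
      filter_upwards [mem_inf_of_right (mem_principal_self _)] with z hz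
      exact ofReal_mul_mem_closedUpper hξ0 hz

/-- Uniqueness of the comb map: the composition with the inverse of `combLimit` is an automorphism
of the half-plane fixing `∞`, hence affine, and is determined by the values at `±1`. -/
lemma IsCombMap.eqOn_combLimit (hξ : 2 < ξ) {f : ℂ → ℂ} (hf : IsCombMap (combHeight ξ) f) :
    EqOn f (fun z => combLimit ξ (ξ * z)) closedUpper := by
  have hb := bijOn_combLimit hξ
  set g := Function.invFunOn (combLimit ξ) openUpper
  have hg := hb.invOn_invFunOn
  have hgb : BijOn g (combDomain (combHeight ξ)) openUpper := hb.symm hg.symm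
  have hd : DifferentiableOn ℂ (fun z => g (f z)) openUpper := by
    intro z hz
    obtain ⟨v, hv, hvz⟩ := hb.surjOn (hf.conformal.2.mapsTo hz)
    have h1 : DifferentiableAt ℂ g (f z) := hvz ▸
      differentiableAt_of_leftInvOn isOpen_openUpper (differentiableOn_combLimit hξ) hg.1 hv
    exact h1.comp_differentiableWithinAt z (hf.conformal.1 z hz)
  have hval : ∀ z ∈ openUpper, combLimit ξ (g (f z)) = f z := fun z hz =>
    hg.2 (hf.conformal.2.mapsTo hz)
  have hφb : BijOn (fun z => g (f z)) openUpper openUpper := hgb.comp hf.conformal.2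
  have hinf : Tendsto (fun z => g (f z)) (cocompact ℂ ⊓ 𝓟 openUpper) (cocompact ℂ) := by
    intro S hS
    obtain ⟨K, hK, hKS⟩ := mem_cocompact.1 hS
    have hcomp : IsCompact (combLimit ξ '' (K ∩ closedUpper)) :=
      (hK.inter_right isClosed_closedUpper).image_of_continuousOn
        ((isStripMap_combLimit hξ).continuousOn.mono inter_subset_right)
    have h1 := hf.map_infty.mono_left
      (inf_le_inf_left _ (principal_mono.2 openUpper_subset_closedUpper))
      hcomp.compl_mem_cocompact
    have h2 : openUpper ∈ cocompact ℂ ⊓ 𝓟 openUpper := mem_inf_of_right (mem_principal_self _)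
    rw [mem_map] at h1 ⊢
    filter_upwards [h1, h2] with z hz1 hz
    refine hKS fun hzK => hz1 ⟨g (f z), ⟨hzK, ?_⟩, hval z hz⟩
    exact openUpper_subset_closedUpper (hφb.mapsTo hz)
  obtain ⟨q, p, hq, haff⟩ := exists_affine_of_automorphism hd hφb hinf
  have heq : EqOn f (fun z => combLimit ξ (q * z + p)) closedUpper := by
    have h1 : EqOn f (fun z => combLimit ξ (q * z + p)) openUpper := fun z hz => by
      simp only
      rw [← haff z hz, hval z hz]
    refine h1.of_subset_closure hf.continuousOn ?_ openUpper_subset_closedUpper ?_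
    · refine (isStripMap_combLimit hξ).continuousOn.comp (by fun_prop) fun z hz => ?_
      change 0 ≤ ((q : ℂ) * z + p).im
      rw [add_im, im_ofReal_mul, ofReal_im, add_zero]
      exact mul_nonneg hq.le hz
    · exact (closure_setOfPred_lt_im 0).ge
  have e1 := heq (ofReal_mem_closedUpper 1)
  have e2 := heq (ofReal_mem_closedUpper (-1))
  have h1 : q + p = ξ := by
    rw [← combLimit_eq_zero_iff hξ, ← hf.map_one]
    simpa using e1.symm
  have h2 : -q + p = -ξ := by
    rw [← combLimit_eq_neg_one_iff hξ, ← hf.map_neg_one]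
    simpa using e2.symm
  have hp : p = 0 := by linarith
  have hqξ : q = ξ := by linarith
  intro z hz
  rw [heq hz, hp, hqξ]
  simp

/-! ### All heights occur -/

/-- The orbit of the critical point under the polynomial, from its second point on (with the sign of
the critical value changed, which does not affect the later points). -/
def critOrbit (ξ : ℝ) : ℕ → ℝ
  | 0 => ξ ^ 2 - ξ
  | n + 1 => critOrbit ξ n ^ 2 - (ξ ^ 2 - ξ)

lemma le_critOrbit (hξ : 2 ≤ ξ) (n : ℕ) : ξ ^ 2 - ξ ≤ critOrbit ξ n := by
  induction n with
  | zero => exact le_rfl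
  | succ n ih =>
    have : 2 ≤ ξ ^ 2 - ξ := by nlinarith
    rw [critOrbit]
    nlinarith

lemma critOrbit_two (n : ℕ) : critOrbit 2 n = 2 := by
  induction n with
  | zero => norm_num [critOrbit]
  | succ n ih => rw [critOrbit, ih]; norm_num

lemma continuous_critOrbit (n : ℕ) : Continuous fun ξ => critOrbit ξ n := by
  induction n with
  | zero => simp only [critOrbit]; fun_prop
  | succ n ih => simp only [critOrbit]; fun_prop

lemma iterate_quadFix_critOrbit (n : ℕ) :
    (quadFix ξ)^[n] ((ξ ^ 2 - ξ : ℝ) : ℂ) = critOrbit ξ n := by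
  induction n with
  | zero => rfl
  | succ n ih => rw [Function.iterate_succ_apply', ih, quadFix_ofReal, critOrbit]

lemma abs_log_critOrbit_sub_le (hξ : 2 ≤ ξ) (n : ℕ) :
    |Real.log (critOrbit ξ (n + 1)) - 2 * Real.log (critOrbit ξ n)| ≤ Real.log 2 := by
  have h1 := le_critOrbit hξ n
  have h2 : 2 ≤ ξ ^ 2 - ξ := by nlinarith
  set y := critOrbit ξ n
  have hy : 0 < y := by linarith
  have hstep : critOrbit ξ (n + 1) = y ^ 2 - (ξ ^ 2 - ξ) := rfl
  have h3 : y ^ 2 / 2 ≤ y ^ 2 - (ξ ^ 2 - ξ) := by nlinarith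
  have h4 : y ^ 2 - (ξ ^ 2 - ξ) ≤ y ^ 2 := by linarith
  have h5 := Real.log_le_log (by positivity) h3
  have h6 := Real.log_le_log (lt_of_lt_of_le (by positivity) h3) h4
  rw [Real.log_div (by positivity) (by norm_num), Real.log_pow, Nat.cast_ofNat] at h5
  rw [Real.log_pow, Nat.cast_ofNat] at h6
  have h7 : 0 ≤ Real.log 2 := Real.log_nonneg (by norm_num)
  rw [hstep, abs_le]
  constructor <;> linarith

lemma abs_log_critOrbit_sub_combHeight_le (hξ : 2 < ξ) (n : ℕ) :
    |Real.log (critOrbit ξ n) / 2 ^ n - Real.pi * combHeight ξ| ≤ Real.log 2 / 2 ^ n := by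
  have hlim : Tendsto (fun n => Real.log (critOrbit ξ n) / 2 ^ n) atTop
      (𝓝 (Real.pi * combHeight ξ)) := by
    have h1 : Tendsto (fun n => Real.pi * (combApprox ξ n ((ξ ^ 2 - ξ : ℝ) : ℂ)).im) atTop
        (𝓝 (Real.pi * (combLimit ξ ((ξ ^ 2 - ξ : ℝ) : ℂ)).im)) :=
      ((continuous_im.tendsto _).comp
        (tendsto_combApprox hξ (ofReal_mem_closedUpper _))).const_mul _
    rw [combHeight, combLimit_neg_ofReal_im hξ]
    refine h1.congr fun n => ?_
    have h2 := le_critOrbit hξ.le n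
    have h3 : 0 ≤ critOrbit ξ n := by nlinarith
    have h4 := log_norm_iterate_quadFix hξ n (ofReal_mem_closedUpper (ξ ^ 2 - ξ)) (by
      rw [iterate_quadFix_critOrbit, norm_real, Real.norm_of_nonneg h3]
      nlinarith)
    rw [iterate_quadFix_critOrbit, norm_real, Real.norm_of_nonneg h3] at h4
    rw [h4]
    field_simp
  have hd : ∀ n, dist (Real.log (critOrbit ξ n) / 2 ^ n)
      (Real.log (critOrbit ξ (n + 1)) / 2 ^ (n + 1)) ≤ Real.log 2 / 2 * (1 / 2) ^ n := by
    intro n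
    have h1 := abs_log_critOrbit_sub_le hξ.le n
    rw [dist_comm, Real.dist_eq, show Real.log (critOrbit ξ (n + 1)) / 2 ^ (n + 1) -
      Real.log (critOrbit ξ n) / 2 ^ n = (Real.log (critOrbit ξ (n + 1)) -
        2 * Real.log (critOrbit ξ n)) / 2 ^ (n + 1) by rw [pow_succ]; field_simp, abs_div,
      abs_of_pos (show (0 : ℝ) < 2 ^ (n + 1) by positivity), one_div, inv_pow, ← div_eq_mul_inv,
      div_div, pow_succ']
    gcongr
  have := dist_le_of_le_geometric_of_tendsto _ _ (by norm_num) hd hlim n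
  rw [Real.dist_eq] at this
  refine this.trans (le_of_eq ?_)
  rw [one_div, inv_pow]
  field_simp
  norm_num

lemma continuousOn_log_critOrbit (n : ℕ) :
    ContinuousOn (fun ξ => Real.log (critOrbit ξ n) / 2 ^ n) (Ici 2) := by
  refine ((continuous_critOrbit n).continuousOn.log fun ξ hξ => ?_).div_const _
  have hξ' : 2 ≤ ξ := hξ
  have := le_critOrbit hξ' n
  nlinarith

lemma continuousOn_combHeight : ContinuousOn combHeight (Ioi 2) := by
  have hunif : TendstoUniformlyOn (fun n ξ => Real.log (critOrbit ξ n) / 2 ^ n)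
      (fun ξ => Real.pi * combHeight ξ) atTop (Ioi 2) := by
    rw [Metric.tendstoUniformlyOn_iff]
    intro ε hε
    have h0 : Tendsto (fun n : ℕ => Real.log 2 * (1 / 2 : ℝ) ^ n) atTop (𝓝 (Real.log 2 * 0)) :=
      (tendsto_pow_atTop_nhds_zero_of_lt_one (by norm_num) (by norm_num)).const_mul _
    rw [mul_zero] at h0
    filter_upwards [h0.eventually (eventually_lt_nhds hε)] with n hn ξ hξ
    rw [dist_comm, Real.dist_eq]
    refine (abs_log_critOrbit_sub_combHeight_le hξ n).trans_lt ?_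
    rwa [one_div, inv_pow, ← div_eq_mul_inv] at hn
  have hc := hunif.continuousOn (Eventually.frequently (Eventually.of_forall fun n =>
    (continuousOn_log_critOrbit n).mono Ioi_subset_Ici_self))
  have := hc.div_const Real.pi
  simpa [mul_div_cancel_left₀ _ Real.pi_ne_zero] using this

/-- Every height is attained, by the intermediate value theorem: the height tends to `0` as `ξ`
tends to `2` and is unbounded for large `ξ`. -/
lemma exists_combHeight_eq {a : ℝ} (ha : 0 < a) : ∃ ξ : ℝ, 2 < ξ ∧ combHeight ξ = a := by
  have hpi := Real.pi_pos
  have hlog : 0 < Real.log 2 := Real.log_pos (by norm_num)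
  obtain ⟨ξ₁, h1, h1'⟩ : ∃ ξ₁ : ℝ, 2 < ξ₁ ∧ combHeight ξ₁ ≤ a := by
    have h0 : Tendsto (fun n : ℕ => 3 * Real.log 2 * (1 / 2 : ℝ) ^ n) atTop
        (𝓝 (3 * Real.log 2 * 0)) :=
      (tendsto_pow_atTop_nhds_zero_of_lt_one (by norm_num) (by norm_num)).const_mul _
    rw [mul_zero] at h0
    obtain ⟨n, hn⟩ := (h0.eventually (eventually_lt_nhds (mul_pos hpi ha))).exists
    rw [one_div, inv_pow, ← div_eq_mul_inv, mul_div_assoc] at hn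
    have hpos : 0 < Real.log 2 / 2 ^ n := by positivity
    have hc : Tendsto (fun ξ => Real.log (critOrbit ξ n) / 2 ^ n) (𝓝[>] 2)
        (𝓝 (Real.log 2 / 2 ^ n)) := by
      have := ((continuousOn_log_critOrbit n) 2 self_mem_Ici).mono Ioi_subset_Ici_self
      rwa [ContinuousWithinAt, critOrbit_two] at this
    obtain ⟨ξ₁, hlt, hξ₁⟩ := ((hc.eventually (eventually_lt_nhds
      (show Real.log 2 / 2 ^ n < 2 * (Real.log 2 / 2 ^ n) by linarith))).and
        self_mem_nhdsWithin).exists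
    refine ⟨ξ₁, hξ₁, ?_⟩
    have := (abs_le.1 (abs_log_critOrbit_sub_combHeight_le hξ₁ n)).1
    refine le_of_mul_le_mul_left ?_ hpi
    linarith
  obtain ⟨ξ₂, h2, h2'⟩ : ∃ ξ₂ : ℝ, 2 < ξ₂ ∧ a ≤ combHeight ξ₂ := by
    have hexp := Real.exp_pos (Real.pi * a)
    refine ⟨2 * Real.exp (Real.pi * a) + 2, by linarith, ?_⟩
    set ξ₂ := 2 * Real.exp (Real.pi * a) + 2
    have hξ₂ : 2 < ξ₂ := by linarith
    have h3 := (abs_le.1 (abs_log_critOrbit_sub_combHeight_le hξ₂ 0)).2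
    have h4 : Real.log (2 * Real.exp (Real.pi * a)) ≤ Real.log (critOrbit ξ₂ 0) := by
      refine Real.log_le_log (by positivity) ?_
      rw [critOrbit]
      nlinarith
    rw [Real.log_mul (by norm_num) hexp.ne', Real.log_exp] at h4
    simp only [pow_zero, div_one] at h3
    refine le_of_mul_le_mul_left ?_ hpi
    linarith
  obtain ⟨ξ, hξ, h⟩ := isPreconnected_Ioi.intermediate_value h1 h2 continuousOn_combHeight
    ⟨h1', h2'⟩
  exact ⟨ξ, hξ, h⟩

/-! ### Comb maps in terms of the dynamical construction -/

lemma reflectedExtension_eq_of_eqOn (hξ : 0 < ξ) {f g : ℂ → ℂ}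
    (h : EqOn f (fun z => g (ξ * z)) closedUpper) (z : ℂ) :
    reflectedExtension f z = reflectedExtension g (ξ * z) := by
  have him : ((ξ : ℂ) * z).im = ξ * z.im := im_ofReal_mul _ _
  rcases lt_or_ge z.im 0 with hz | hz
  · have hz' : conj z ∈ closedUpper := by
      change 0 ≤ (conj z).im
      rw [conj_im]; linarith
    rw [reflectedExtension_of_im_neg hz, reflectedExtension_of_im_neg
      (by rw [him]; exact mul_neg_of_pos_of_neg hξ hz), h hz', map_mul, conj_ofReal]
  · rw [reflectedExtension_of_mem hz, reflectedExtension_of_mem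
      (ofReal_mul_mem_closedUpper hξ hz), h hz]

/-- Every comb map arises from a polynomial. -/
lemma IsCombMap.exists_fixedPoint {a : ℝ} (ha : 0 < a) {f : ℂ → ℂ} (hf : IsCombMap a f) :
    ∃ ξ : ℝ, 2 < ξ ∧ combHeight ξ = a ∧ EqOn f (fun z => combLimit ξ (ξ * z)) closedUpper := by
  obtain ⟨ξ, hξ, rfl⟩ := exists_combHeight_eq ha
  exact ⟨ξ, hξ, rfl, hf.eqOn_combLimit hξ⟩

lemma map_neg_eq_slitTip_iff (hξ : 2 < ξ) {f : ℂ → ℂ}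
    (hf : EqOn f (fun z => combLimit ξ (ξ * z)) closedUpper) (ν : ℝ) :
    f (-(ν : ℂ)) = -1 + combHeight ξ * I ↔ ν = ξ - 1 := by
  have h1 := hf (ofReal_mem_closedUpper (-ν))
  simp only at h1
  rw [← ofReal_mul, ofReal_neg] at h1
  rw [h1, combLimit_eq_criticalValue_iff hξ]
  have hne : ξ ≠ 0 := by linarith
  constructor
  · intro h
    exact mul_left_cancel₀ hne (by linarith)
  · rintro rfl
    ring

lemma conformalOnto_reflectedExtension_of_eqOn (hξ : 2 < ξ) {f : ℂ → ℂ}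
    (hf : EqOn f (fun z => combLimit ξ (ξ * z)) closedUpper) :
    ConformalOnto (reflectedExtension f) (cutPlane (-(ξ - 1))) (doubledComb (combHeight ξ)) := by
  have hξ0 : 0 < ξ := by linarith
  have hξc : (ξ : ℂ) ≠ 0 := ofReal_ne_zero.2 hξ0.ne'
  have hfun : reflectedExtension f = reflectedExtension (combLimit ξ) ∘ fun z => (ξ : ℂ) * z :=
    funext fun z => reflectedExtension_eq_of_eqOn hξ0 hf z
  have hmem : ∀ z : ℂ, (ξ : ℂ) * z ∈ cutPlane (-(ξ ^ 2 - ξ)) ↔ z ∈ cutPlane (-(ξ - 1)) := by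
    intro z
    have h1 : -(ξ ^ 2 - ξ) ≤ ξ * z.re ↔ -(ξ - 1) ≤ z.re := by
      rw [show -(ξ ^ 2 - ξ) = ξ * (-(ξ - 1)) by ring, mul_le_mul_iff_right₀ hξ0]
    simp only [cutPlane, mem_ofPred_eq, im_ofReal_mul, re_ofReal_mul, h1, mul_eq_zero, hξ0.ne',
      false_or]
  have hbij : BijOn (fun z : ℂ => (ξ : ℂ) * z) (cutPlane (-(ξ - 1))) (cutPlane (-(ξ ^ 2 - ξ))) := by
    refine ⟨fun z hz => (hmem z).2 hz, fun z _ w _ h => mul_left_cancel₀ hξc h,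
      fun z hz => ⟨(ξ : ℂ)⁻¹ * z, ?_, mul_inv_cancel_left₀ hξc z⟩⟩
    rwa [← hmem, mul_inv_cancel_left₀ hξc]
  obtain ⟨h1, h2⟩ := conformalOnto_reflectedExtension hξ
  rw [hfun]
  exact ⟨h1.comp (by fun_prop) hbij.mapsTo, h2.comp hbij⟩

lemma rescale_reflectedExtension (hξ : 2 < ξ) {f : ℂ → ℂ}
    (hf : EqOn f (fun z => combLimit ξ (ξ * z)) closedUpper) :
    rescale ξ (reflectedExtension f) = reflectedExtension (combLimit ξ) := by
  have hξ0 : 0 < ξ := by linarith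
  funext z
  rw [rescale, reflectedExtension_eq_of_eqOn hξ0 hf, mul_div_cancel₀ _ (ofReal_ne_zero.2 hξ0.ne')]

lemma rescale_apply_of_mem (hξ : 2 < ξ) {f : ℂ → ℂ}
    (hf : EqOn f (fun z => combLimit ξ (ξ * z)) closedUpper) {z : ℂ} (hz : z ∈ closedUpper) :
    rescale ξ f z = combLimit ξ z := by
  have hξ0 : 0 < ξ := by linarith
  have h := hf (ofReal_mul_mem_closedUpper (inv_pos.2 hξ0) hz)
  rw [ofReal_inv] at h
  rw [rescale, div_eq_inv_mul, h]
  simp only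
  rw [mul_inv_cancel_left₀ (ofReal_ne_zero.2 hξ0.ne')]

/-- A polynomial is represented by the comb map constructed from it, and by no other comb map. -/
lemma combRepresents_iff {ξ' : ℝ} (hξ : 2 < ξ) (hξ' : 2 < ξ') {f : ℂ → ℂ}
    (hf : EqOn f (fun z => combLimit ξ (ξ * z)) closedUpper) :
    CombRepresents (ξ' ^ 2 - ξ') f (ξ - 1) ↔ ξ' = ξ := by
  rw [CombRepresents]
  simp only [sub_add_cancel, rescale_reflectedExtension hξ hf]
  rw [show ξ * (ξ - 1) = ξ ^ 2 - ξ by ring]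
  constructor
  · intro h
    have hI : I ∈ openUpper := by simp [openUpper]
    obtain ⟨h1, h2⟩ := h I hI
    rw [rescale_apply_of_mem hξ hf (openUpper_subset_closedUpper hI),
      ← reflectedExtension_combLimit_quadFix hξ hI] at h2
    have h3 := congrArg re (reflectedExtension_combLimit_injOn hξ h1 (quadFix_mem_cutPlane hI) h2)
    rw [quadFix_re, quadFix_re] at h3
    have h4 : (ξ' - ξ) * (ξ' + ξ - 1) = 0 := by linear_combination -h3
    rcases mul_eq_zero.1 h4 with h | h <;> linarith
  · rintro rfl z hz
    refine ⟨quadFix_mem_cutPlane hz, ?_⟩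
    rw [rescale_apply_of_mem hξ hf (openUpper_subset_closedUpper hz)]
    exact reflectedExtension_combLimit_quadFix hξ hz

/-! ### The function `exp (i π θ)` -/

lemma exp_pi_mul_reflectLine (z : ℂ) :
    exp (I * Real.pi * reflectLine z) = conj (exp (I * Real.pi * z)) := by
  rw [← exp_conj, exp_eq_exp_iff_exists_int]
  refine ⟨-1, ?_⟩
  simp [reflectLine]
  ring

/-- The function `exp (i π θ)`, that is, the reciprocal of the Böttcher coordinate at infinity. On the
real axis it takes its boundary values from above. -/
noncomputable def combExp (ξ : ℝ) : ℂ → ℂ := expPi (reflectedExtension (combLimit ξ))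

lemma combExp_of_mem {z : ℂ} (hz : z ∈ closedUpper) :
    combExp ξ z = exp (I * Real.pi * combLimit ξ z) := by
  rw [combExp, expPi, reflectedExtension_of_mem hz]

lemma combExp_of_im_neg {z : ℂ} (hz : z.im < 0) : combExp ξ z = conj (combExp ξ (conj z)) := by
  have hz' : conj z ∈ closedUpper := by
    change 0 ≤ (conj z).im
    rw [conj_im]; linarith
  rw [combExp_of_mem hz', combExp, expPi, reflectedExtension_of_im_neg hz, exp_pi_mul_reflectLine]

lemma combExp_conj {z : ℂ} (hz : z.im ≠ 0) : combExp ξ (conj z) = conj (combExp ξ z) := by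
  rcases hz.lt_or_gt with h | h
  · rw [combExp_of_im_neg h, conj_conj]
  · rw [combExp_of_im_neg (z := conj z) (by simpa using h), conj_conj]

lemma combExp_ne_zero (z : ℂ) : combExp ξ z ≠ 0 := exp_ne_zero _

lemma combExp_quadFix_of_re_nonneg (hξ : 2 < ξ) {z : ℂ} (hz : z ∈ closedUpper) (h : 0 ≤ z.re) :
    combExp ξ (quadFix ξ z) = combExp ξ z ^ 2 := by
  rw [combExp_of_mem hz, combExp_of_mem (quadFix_mem_closedUpper hz h),
    ← two_mul_combLimit_of_re_nonneg hξ hz h, ← exp_nat_mul]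
  congr 1
  push_cast
  ring

lemma conj_combExp_conj_quadFix_of_re_nonpos (hξ : 2 < ξ) {z : ℂ} (hz : z ∈ closedUpper)
    (h : z.re ≤ 0) : conj (combExp ξ (conj (quadFix ξ z))) = combExp ξ z ^ 2 := by
  rw [combExp_of_mem hz, combExp_of_mem (conj_quadFix_mem_closedUpper hz h),
    ← exp_pi_mul_reflectLine, ← two_mul_combLimit_of_re_nonpos hξ hz h, ← exp_nat_mul]
  congr 1
  push_cast
  ring

/-- On the real axis outside of `(-ξ, ξ)` both boundary values agree. -/
lemma conj_combExp_ofReal (hξ : 2 < ξ) {x : ℝ} (hx : ξ ≤ |x|) :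
    conj (combExp ξ x) = combExp ξ x := by
  rw [combExp_of_mem (ofReal_mem_closedUpper x), ← exp_conj, exp_eq_exp_iff_exists_int]
  rcases le_abs.1 hx with h | h
  · have hre := (isStripMap_combLimit hξ).re_right x h
    refine ⟨0, ?_⟩
    apply Complex.ext <;> simp [hre]
  · have hre := (isStripMap_combLimit hξ).re_left x (by linarith)
    refine ⟨1, ?_⟩
    apply Complex.ext <;> simp [hre]
    ring

lemma mem_compl_realInterval_iff {z : ℂ} :
    z ∈ (realInterval ξ)ᶜ ↔ z.im ≠ 0 ∨ ∃ x : ℝ, z = x ∧ ξ < |x| := by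
  simp only [mem_compl_iff, realInterval, mem_ofPred_eq, mem_Icc, ← abs_le]
  constructor
  · intro h
    by_cases him : z.im = 0
    · refine Or.inr ⟨z.re, Complex.ext rfl (by simpa using him), ?_⟩
      by_contra! hle
      exact h ⟨him, hle⟩
    · exact Or.inl him
  · rintro (h | ⟨x, rfl, hx⟩) ⟨h1, h2⟩
    · exact h h1
    · simp at h2; linarith

lemma isOpen_compl_realInterval : IsOpen (realInterval ξ)ᶜ := by
  refine IsClosed.isOpen_compl (self := ?_)
  exact (isClosed_eq continuous_im continuous_const).inter
    (isClosed_Icc.preimage continuous_re)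

/-- The complement of `[-ξ, ξ]` is invariant under the polynomial. -/
lemma quadFix_mem_compl_realInterval (hξ : 2 < ξ) {z : ℂ} (hz : z ∈ (realInterval ξ)ᶜ) :
    quadFix ξ z ∈ (realInterval ξ)ᶜ := by
  rintro ⟨h1, h2⟩
  rw [quadFix_im] at h1
  rw [quadFix_re, mem_Icc] at h2
  have him : z.im = 0 := by
    by_contra hne
    have hre : z.re = 0 := by
      rcases mul_eq_zero.1 h1 with h | h
      · linarith
      · exact absurd h hne
    rw [hre] at h2
    nlinarith [sq_nonneg z.im]
  rw [him] at h2
  exact hz ⟨him, abs_le.1 (abs_le_of_sq_le_sq (by linarith [h2.2]) (by linarith))⟩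

lemma combExp_quadFix (hξ : 2 < ξ) {z : ℂ} (hz : z ∈ (realInterval ξ)ᶜ) :
    combExp ξ (quadFix ξ z) = combExp ξ z ^ 2 := by
  have hup : ∀ z : ℂ, 0 < z.im → combExp ξ (quadFix ξ z) = combExp ξ z ^ 2 := by
    intro z hz
    have hzo : z ∈ openUpper := hz
    have hzc := openUpper_subset_closedUpper hzo
    rcases le_or_gt 0 z.re with h | h
    · exact combExp_quadFix_of_re_nonneg hξ hzc h
    · rw [← conj_combExp_conj_quadFix_of_re_nonpos hξ hzc h.le, combExp_conj, conj_conj]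
      have : 0 < (conj (quadFix ξ z)).im := conj_quadFix_mem_openUpper hzo h
      rw [conj_im] at this
      linarith
  rcases mem_compl_realInterval_iff.1 hz with h | ⟨x, rfl, hx⟩
  · rcases h.lt_or_gt with h | h
    · have h1 := hup (conj z) (by simpa using h)
      rw [combExp_conj h.ne, ← map_pow, quadFix_conj] at h1
      rw [← conj_conj (combExp ξ z ^ 2), ← h1]
      rcases eq_or_ne (quadFix ξ z).im 0 with h0 | h0
      · -- here `P z` is real and to the left of the critical value
        have hr : quadFix ξ z = ((quadFix ξ z).re : ℂ) := Complex.ext rfl (by simpa using h0)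
        have hre : z.re = 0 := by
          rw [quadFix_im] at h0
          rcases mul_eq_zero.1 h0 with h' | h'
          · linarith
          · exact absurd h' h.ne
        rw [hr, conj_ofReal, conj_combExp_ofReal hξ]
        rw [le_abs, quadFix_re, hre]
        right
        nlinarith [sq_nonneg z.im]
      · rw [combExp_conj h0, conj_conj]
    · exact hup z h
  · rcases le_total 0 x with h | h
    · exact combExp_quadFix_of_re_nonneg hξ (ofReal_mem_closedUpper x) (by simpa using h)
    · rw [← conj_combExp_conj_quadFix_of_re_nonpos hξ (ofReal_mem_closedUpper x) (by simpa using h),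
        quadFix_ofReal, conj_ofReal, conj_combExp_ofReal hξ]
      rw [← sq_abs x]
      exact (by nlinarith : ξ ≤ |x| ^ 2 - (ξ ^ 2 - ξ)).trans (le_abs_self _)

/-- The symmetry `z ↦ -z` of the polynomial changes the sign of `exp (i π θ)`. -/
lemma combExp_neg (hξ : 2 < ξ) {z : ℂ} (hz : z ∈ (realInterval ξ)ᶜ) :
    combExp ξ (-z) = -combExp ξ z := by
  have key : ∀ w ∈ closedUpper, combExp ξ (-conj w) = -conj (combExp ξ w) := by
    intro w hw
    have hw' : -conj w ∈ closedUpper := by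
      change 0 ≤ (-conj w).im
      simpa using show 0 ≤ w.im from hw
    have hneg : ∀ c : ℂ, -exp c = exp (Real.pi * I + c) := fun c => by
      rw [exp_add, exp_pi_mul_I, neg_one_mul]
    rw [combExp_of_mem hw', combExp_of_mem hw, combLimit_neg_conj hξ hw, ← exp_conj, hneg,
      exp_eq_exp_iff_exists_int]
    refine ⟨-1, ?_⟩
    simp
    ring
  rcases mem_compl_realInterval_iff.1 hz with h | ⟨x, rfl, hx⟩
  · rcases h.lt_or_gt with h | h
    · have h1 := key (conj z) (show 0 ≤ (conj z).im by rw [conj_im]; linarith)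
      rwa [conj_conj, combExp_conj h.ne, conj_conj] at h1
    · have h1 := key z (show 0 ≤ z.im from h.le)
      rw [← conj_conj (-z), combExp_conj (by simpa using h.ne'), map_neg, h1]
      simp
  · have h1 := key x (ofReal_mem_closedUpper x)
    rwa [conj_ofReal, conj_combExp_ofReal hξ hx.le] at h1

lemma continuousOn_combExp (hξ : 2 < ξ) : ContinuousOn (combExp ξ) closedUpper := by
  have h : ContinuousOn (fun z => exp (I * Real.pi * combLimit ξ z)) closedUpper :=
    ((isStripMap_combLimit hξ).continuousOn.const_mul _).cexp
  exact h.congr fun z hz => combExp_of_mem hz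

lemma tendsto_combExp_above (hξ : 2 < ξ) (x : ℝ) :
    Tendsto (combExp ξ) (𝓝[{z | 0 < z.im}] (x : ℂ)) (𝓝 (combExp ξ x)) :=
  (continuousOn_combExp hξ _ (ofReal_mem_closedUpper x)).mono_left
    (nhdsWithin_mono _ openUpper_subset_closedUpper)

lemma tendsto_combExp_below (hξ : 2 < ξ) (x : ℝ) :
    Tendsto (combExp ξ) (𝓝[{z | z.im < 0}] (x : ℂ)) (𝓝 (conj (combExp ξ x))) := by
  have h1 : Tendsto (fun z : ℂ => conj z) (𝓝[{z | z.im < 0}] (x : ℂ)) (𝓝[{z | 0 < z.im}] (x : ℂ)) := by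
    refine tendsto_nhdsWithin_iff.2 ⟨?_, ?_⟩
    · have := continuous_conj.tendsto (x : ℂ)
      rw [conj_ofReal] at this
      exact this.mono_left nhdsWithin_le_nhds
    · filter_upwards [self_mem_nhdsWithin] with z hz
      simpa using hz
  have h2 := (continuous_conj.tendsto _).comp ((tendsto_combExp_above hξ x).comp h1)
  refine h2.congr' ?_
  filter_upwards [self_mem_nhdsWithin] with z hz
  exact (combExp_of_im_neg hz).symm

lemma continuousAt_combExp_ofReal (hξ : 2 < ξ) {x : ℝ} (hx : ξ ≤ |x|) :
    ContinuousAt (combExp ξ) x := by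
  have h1 : ContinuousWithinAt (combExp ξ) closedUpper x :=
    continuousOn_combExp hξ _ (ofReal_mem_closedUpper x)
  have h2 : ContinuousWithinAt (combExp ξ) {z | z.im < 0} x := by
    have := tendsto_combExp_below hξ x
    rwa [conj_combExp_ofReal hξ hx] at this
  have h3 := h1.union h2
  have huniv : closedUpper ∪ {z | z.im < 0} = univ := by
    ext z
    simpa [closedUpper] using le_or_gt 0 z.im
  rwa [huniv, continuousWithinAt_univ] at h3

/-- A continuous square root of a holomorphic function is holomorphic where it does not vanish. -/
lemma differentiableAt_of_sq {h : ℂ → ℂ} {z : ℂ} (hc : ContinuousAt h z) (h0 : h z ≠ 0)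
    (hd : DifferentiableAt ℂ (fun w => h w ^ 2) z) : DifferentiableAt ℂ h z := by
  have hs := hasDerivAt_iff_tendsto_slope.1 hd.hasDerivAt
  have hsum : Tendsto (fun w => h w + h z) (𝓝[≠] z) (𝓝 (h z + h z)) :=
    (hc.tendsto.mono_left nhdsWithin_le_nhds).add_const _
  have hne : h z + h z ≠ 0 := by rw [← two_mul]; exact mul_ne_zero two_ne_zero h0
  refine (hasDerivAt_iff_tendsto_slope.2 ((hs.div hsum hne).congr' ?_)).differentiableAt
  filter_upwards [hsum.eventually_ne hne] with w hw
  simp only [Pi.div_apply, slope_def_field]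
  rw [div_div, mul_comm, ← div_div, sq_sub_sq, mul_comm, mul_div_assoc]
  field_simp

/-- Off the real axis and far to the left this is holomorphy of `θ`, far to the right it follows by
symmetry, and for the remaining points `G ∘ P = G ^ 2` transports it back along the orbit. -/
lemma differentiableAt_combExp (hξ : 2 < ξ) {z : ℂ} (hz : z ∈ (realInterval ξ)ᶜ) :
    DifferentiableAt ℂ (combExp ξ) z := by
  have hcut : ∀ w ∈ cutPlane (-(ξ ^ 2 - ξ)), DifferentiableAt ℂ (combExp ξ) w := by
    intro w hw
    have := (differentiableOn_reflectedExtension hξ).differentiableAt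
      ((isOpen_cutPlane _).mem_nhds hw)
    exact (this.const_mul _).cexp
  rcases mem_compl_realInterval_iff.1 hz with h | ⟨x, rfl, hx⟩
  · exact hcut z fun hc => h hc.1
  have hright : ∀ y : ℝ, ξ ^ 2 - ξ < y → DifferentiableAt ℂ (combExp ξ) y := by
    intro y hy
    have hy' : (y : ℂ) ∈ (realInterval ξ)ᶜ :=
      mem_compl_realInterval_iff.2 (Or.inr ⟨y, rfl, lt_abs.2 (Or.inl (by nlinarith))⟩)
    have h1 : DifferentiableAt ℂ (combExp ξ) (-(y : ℂ)) :=
      hcut _ fun hc => by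
        have := hc.2
        simp at this
        linarith
    have h2 : DifferentiableAt ℂ (fun w => -combExp ξ (-w)) (y : ℂ) :=
      (h1.comp (y : ℂ) differentiableAt_fun_id.neg).neg
    refine h2.congr_of_eventuallyEq ?_
    filter_upwards [isOpen_compl_realInterval.mem_nhds hy'] with w hw
    rw [combExp_neg hξ hw, neg_neg]
  have hback : ∀ y : ℝ, ξ < |y| → DifferentiableAt ℂ (combExp ξ) (quadFix ξ y) →
      DifferentiableAt ℂ (combExp ξ) y := by
    intro y hy hd
    have hy' : (y : ℂ) ∈ (realInterval ξ)ᶜ :=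
      mem_compl_realInterval_iff.2 (Or.inr ⟨y, rfl, hy⟩)
    refine differentiableAt_of_sq (continuousAt_combExp_ofReal hξ hy.le) (combExp_ne_zero _) ?_
    refine (hd.comp (y : ℂ) (differentiable_quadFix _)).congr_of_eventuallyEq ?_
    filter_upwards [isOpen_compl_realInterval.mem_nhds hy'] with w hw
    exact (combExp_quadFix hξ hw).symm
  have hind : ∀ n : ℕ, ∀ y : ℝ, ξ < |y| → ξ ^ 2 - ξ < ‖(quadFix ξ)^[n] y‖ →
      DifferentiableAt ℂ (combExp ξ) y := by
    intro n
    induction n with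
    | zero =>
      intro y _ hn
      rw [Function.iterate_zero, id, norm_real, Real.norm_eq_abs] at hn
      rcases lt_abs.1 hn with h | h
      · exact hright y h
      · exact hcut _ fun hc => by
          have := hc.2
          simp at this
          linarith
    | succ n ih =>
      intro y hy hn
      rw [Function.iterate_succ_apply] at hn
      refine hback y hy ?_
      rw [quadFix_ofReal] at hn ⊢
      refine ih _ ?_ hn
      rw [← sq_abs y]
      exact (by nlinarith : ξ < |y| ^ 2 - (ξ ^ 2 - ξ)).trans_le (le_abs_self _)
  have hnorm : ξ < ‖(x : ℂ)‖ := by rwa [norm_real, Real.norm_eq_abs]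
  obtain ⟨n, hn⟩ := ((tendsto_norm_iterate_quadFix hξ hnorm).eventually
    (eventually_gt_atTop (ξ ^ 2 - ξ))).exists
  exact hind n x hx hn

/-! ### The Julia set -/

lemma mem_juliaSet_iff (hξ : 2 < ξ) (z : ℂ) :
    z ∈ juliaSet (ξ ^ 2 - ξ) ↔ ∀ n, ‖(quadFix ξ)^[n] z‖ ≤ ξ := by
  rw [juliaSet, mem_compl_iff, mem_basinOfInfinity_iff hξ]
  push Not
  rfl

lemma mem_segment_neg_one_zero_iff (w : ℂ) :
    w ∈ segment ℝ (-1 : ℂ) 0 ↔ w.im = 0 ∧ w.re ∈ Icc (-1 : ℝ) 0 := by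
  rw [segment_eq_image']
  constructor
  · rintro ⟨t, ht, rfl⟩
    simpa using ⟨ht.1, ht.2⟩
  · rintro ⟨h1, h2⟩
    refine ⟨w.re + 1, ⟨by linarith [h2.1], by linarith [h2.2]⟩, Complex.ext ?_ ?_⟩
    · simp
    · simp [h1]

lemma setOf_combLimit_mem_segment (hξ : 2 < ξ) :
    {z | z ∈ closedUpper ∧ combLimit ξ z ∈ segment ℝ (-1 : ℂ) 0} = juliaSet (ξ ^ 2 - ξ) := by
  ext z
  rw [mem_ofPred_eq, mem_juliaSet_iff hξ, mem_segment_neg_one_zero_iff]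
  constructor
  · rintro ⟨hz, h, -⟩
    exact (combLimit_im_eq_zero_iff hξ hz).1 h
  · intro h
    have hz : z ∈ closedUpper := by
      by_contra hneg
      have him : z.im < 0 := not_le.1 hneg
      obtain ⟨n, hn⟩ := exists_lt_norm_iterate_of_im_ne_zero hξ him.ne
      exact absurd (h n) (not_le.2 hn)
    exact ⟨hz, (combLimit_im_eq_zero_iff hξ hz).2 h, (isStripMap_combLimit hξ).re_mem z hz⟩

theorem mainTheorem2 (lam : ℝ) (hlam : 2 < lam) :
    -- the normalised conformal map `f` onto the comb domain, the point `-ν` that `f` sends to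
    -- `-1 + a i`, and the conformal extension by reflection are well defined for every `a > 0`
    (∀ a : ℝ, 0 < a →
      (∃ f : ℂ → ℂ, IsCombMap a f) ∧
      (∀ f g : ℂ → ℂ, IsCombMap a f → IsCombMap a g → EqOn f g closedUpper) ∧
      (∀ f : ℂ → ℂ, IsCombMap a f →
        (∃! ν : ℝ, f (-(ν : ℂ)) = -1 + a * I) ∧
        (∀ ν : ℝ, f (-(ν : ℂ)) = -1 + a * I →
          ConformalOnto (reflectedExtension f) (cutPlane (-ν)) (doubledComb a)))) ∧
    -- there is a unique `a > 0` with `P = θ⁻¹ ∘ 2 θ₀`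
    (∃! a : ℝ, 0 < a ∧ ∃ (f : ℂ → ℂ) (ν : ℝ),
      IsCombMap a f ∧ f (-(ν : ℂ)) = -1 + a * I ∧ CombRepresents lam f ν) ∧
    -- the properties of the representation
    (∀ (a : ℝ) (f : ℂ → ℂ) (ν : ℝ), 0 < a → IsCombMap a f → f (-(ν : ℂ)) = -1 + a * I →
      CombRepresents lam f ν →
      ∀ (ξ : ℝ) (θ₀ θ G : ℂ → ℂ), ξ = ν + 1 → θ₀ = rescale ξ f →
        θ = rescale ξ (reflectedExtension f) → G = expPi θ →
        -- `θ₀` and `θ` are conformal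
        ConformalOnto θ₀ openUpper (combDomain a) ∧
        ConformalOnto θ (cutPlane (-(ξ * ν))) (doubledComb a) ∧
        -- `ξ` is the positive fixed point of `P`
        (∀ x : ℝ, (0 < x ∧ quadMap lam x = x) ↔ x = ξ) ∧
        -- `G` is analytic off `[-ξ, ξ]` and satisfies the identity there
        DifferentiableOn ℂ G (realInterval ξ)ᶜ ∧
        (∀ z ∈ (realInterval ξ)ᶜ, quadMap lam z ∈ (realInterval ξ)ᶜ ∧
          G (quadMap lam z) = G z ^ 2) ∧
        -- the boundary values of `G` on `[-ξ, ξ]` from above and from below, and the identity for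
        -- them (`P` preserves the sides of `[0, ξ]` and exchanges those of `[-ξ, 0]`)
        (∀ x ∈ Icc (-ξ) ξ,
          Tendsto G (𝓝[{z | 0 < z.im}] (x : ℂ)) (𝓝 (G x)) ∧
          Tendsto G (𝓝[{z | z.im < 0}] (x : ℂ)) (𝓝 ((starRingEnd ℂ) (G x))) ∧
          (0 ≤ x → G (quadMap lam x) = G x ^ 2) ∧
          (x ≤ 0 → (starRingEnd ℂ) (G (quadMap lam x)) = G x ^ 2)) ∧
        -- `θ₀⁻¹([-1, 0])` is the Julia set
        {z | z ∈ closedUpper ∧ θ₀ z ∈ segment ℝ (-1 : ℂ) 0} = juliaSet lam) := by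
  obtain ⟨ξ₀, hξ₀, rfl⟩ : ∃ ξ : ℝ, 2 < ξ ∧ lam = ξ ^ 2 - ξ := by
    have h9 : (3 : ℝ) < √(1 + 4 * lam) := by
      rw [Real.lt_sqrt (by norm_num)]; linarith
    have hsq : √(1 + 4 * lam) ^ 2 = 1 + 4 * lam := Real.sq_sqrt (by linarith)
    exact ⟨(1 + √(1 + 4 * lam)) / 2, by linarith, by nlinarith⟩
  refine ⟨fun a ha => ⟨?_, fun f g hf hg => ?_, fun f hf => ?_⟩, ?_, ?_⟩
  · obtain ⟨ξ, hξ, rfl⟩ := exists_combHeight_eq ha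
    exact ⟨_, isCombMap_combLimit hξ⟩
  · obtain ⟨ξ, hξ, rfl⟩ := exists_combHeight_eq ha
    exact (hf.eqOn_combLimit hξ).trans (hg.eqOn_combLimit hξ).symm
  · obtain ⟨ξ, hξ, rfl, hfξ⟩ := hf.exists_fixedPoint ha
    simp only [map_neg_eq_slitTip_iff hξ hfξ]
    refine ⟨⟨ξ - 1, rfl, fun _ h => h⟩, ?_⟩
    rintro ν rfl
    exact conformalOnto_reflectedExtension_of_eqOn hξ hfξ
  · refine ⟨combHeight ξ₀, ⟨combHeight_pos hξ₀, _, ξ₀ - 1, isCombMap_combLimit hξ₀, ?_, ?_⟩, ?_⟩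
    · exact (map_neg_eq_slitTip_iff hξ₀ (fun _ _ => rfl) _).2 rfl
    · exact (combRepresents_iff hξ₀ hξ₀ (fun _ _ => rfl)).2 rfl
    · rintro a ⟨ha, f, ν, hf, hν, hrep⟩
      obtain ⟨ξ, hξ, rfl, hfξ⟩ := hf.exists_fixedPoint ha
      rw [map_neg_eq_slitTip_iff hξ hfξ] at hν
      rw [hν, combRepresents_iff hξ hξ₀ hfξ] at hrep
      rw [hrep]
  · rintro a f ν ha hf hν hrep ξ θ₀ θ G hξν hθ₀ hθ hG
    obtain ⟨ξ', hξ, rfl, hfξ⟩ := hf.exists_fixedPoint ha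
    rw [map_neg_eq_slitTip_iff hξ hfξ] at hν
    rw [hν, combRepresents_iff hξ hξ₀ hfξ] at hrep
    rw [hν, sub_add_cancel] at hξν
    subst hrep hξν hν
    rw [rescale_reflectedExtension hξ hfξ] at hθ
    have hGc : G = combExp ξ := by rw [hG, hθ]; rfl
    have hθ₀c : ∀ z ∈ closedUpper, θ₀ z = combLimit ξ z := fun z hz => by
      rw [hθ₀, rescale_apply_of_mem hξ hfξ hz]
    have hEq : EqOn (combLimit ξ) θ₀ openUpper := fun z hz =>
      (hθ₀c z (openUpper_subset_closedUpper hz)).symm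
    rw [hGc]
    refine ⟨⟨(differentiableOn_combLimit hξ).congr hEq.symm, (bijOn_combLimit hξ).congr hEq⟩,
      ?_, ?_, ?_, ?_, ?_, ?_⟩
    · rw [hθ, show ξ * (ξ - 1) = ξ ^ 2 - ξ by ring]
      exact conformalOnto_reflectedExtension hξ
    · intro x
      change 0 < x ∧ quadFix ξ x = x ↔ x = ξ
      rw [quadFix_ofReal, ofReal_inj]
      constructor
      · rintro ⟨h1, h2⟩
        have h3 : (x - ξ) * (x + ξ - 1) = 0 := by linear_combination h2
        rcases mul_eq_zero.1 h3 with h | h <;> linarith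
      · rintro rfl
        exact ⟨by linarith, by ring⟩
    · exact fun z hz => (differentiableAt_combExp hξ hz).differentiableWithinAt
    · exact fun z hz => ⟨quadFix_mem_compl_realInterval hξ hz, combExp_quadFix hξ hz⟩
    · intro x _
      refine ⟨tendsto_combExp_above hξ x, tendsto_combExp_below hξ x, fun h => ?_, fun h => ?_⟩
      · exact combExp_quadFix_of_re_nonneg hξ (ofReal_mem_closedUpper x) (by simpa using h)
      · have := conj_combExp_conj_quadFix_of_re_nonpos hξ (ofReal_mem_closedUpper x)
          (by simpa using h)
        rwa [quadFix_ofReal, conj_ofReal, ← quadFix_ofReal] at this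
    · rw [← setOf_combLimit_mem_segment hξ]
      ext z
      simp only [mem_ofPred_eq]
      exact and_congr_right fun hz => by rw [hθ₀c z hz]
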